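/- Let $\mathbf T=[0,\infty)$ with Lebesgue measure $\lambda$, let $\mathbf X$ be a finite-dimensional real normed space, let $x_0\in\mathbf X$, and let $P$, $Q$ be compact subsets of finite-dimensional real normed spaces. Let $f:\mathbf T\times\mathbf X\times P\times Q\to\mathbf X$ be a function such that 1) $f$ is continuous; 2) for every compact $A\subset\mathbf T\times\mathbf X$ there is a $\lambda$-integrable function $L_A:\mathbf T\to\mathbf R$ with $\|f(t,x_1,u,v)-f(t,x_2,u,v)\|\le L_A(t)\|x_1-x_2\|$ for all $(t,x_1),(t,x_2)\in A$, $u\in P$, $v\in Q$; 3) there is a locally $\lambda$-integrable function $a:\mathbf T\to\mathbf R$ with $\|f(t,x,u,v)\|\le a(t)(1+\|x\|)$ for all $(t,x,u,v)\in\mathbf T\times\mathbf X\times P\times Q$. Let $\Pi(\mathbf T\times Q)$ be the set of all regular Borel measures $\nu$ on $\mathbf T\times Q$ with $\nu(I\times Q)=\lambda(I)$ for every compact $I\subset\mathbf T$, and let $\Pi(\mathbf T\times P\times Q)$ be the set of all regular Borel measures $\eta$ on $\mathbf T\times P\times Q$ with $\eta(I\times P\times Q)=\lambda(I)$ for every compact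 $I\subset\mathbf T$. For $\nu\in\Pi(\mathbf T\times Q)$ let $\Pi_\nu(\mathbf T\times P\times Q)$ be the set of all $\eta\in\Pi(\mathbf T\times P\times Q)$ with $\eta(I\times P\times A)=\nu(I\times A)$ for all Borel $I\subset\mathbf T$, $A\subset Q$. Let $\Phi_\nu$ be the set of all $x\in C(\mathbf T,\mathbf X)$ that satisfy, for some $\eta\in\Pi_\nu(\mathbf T\times P\times Q)$, $$x(t)=x_0+\int_{[0,t]\times P\times Q}f(\tau,x(\tau),u,v)\,d\eta(\tau,u,v)\qquad\text{for all }t\in\mathbf T,$$ and let $\mathbf V=\{\Phi_\nu\mid\nu\in\Pi(\mathbf T\times Q)\}$. For a closed set $M\subset\mathbf T\times\mathbf X$ put $$c_M(x)=\inf\bigl(\{t\in\mathbf T\mid(t,x(t))\in M\}\cup\{+\infty\}\bigr),\qquad C_M=\sup_{\Phi\in\mathbf V}\inf_{x\in\Phi}c_M(x).$$ The value $C_M=\infty$ is called exact if there is a $\Phi\in\mathbf V$ such that $(t,x(t))\notin M$ for all $x\in\Phi$ and all $t\in\mathbf T$. It is called robust if there is a closed set $\widetilde M\subset\mathbf T\times\mathbf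 X$ whose interior (in $\mathbf T\times\mathbf X$) contains $M$ and for which $C_{\widetilde M}=\infty$. Then for every closed set $M\subset\mathbf T\times\mathbf X$ the value $C_M=\infty$ is exact if and only if it is robust. -/

import Mathlib

open MeasureTheory Set
open scoped NNReal ENNReal

namespace PursuitEvasion

noncomputable section

/-! ### Pursuit-evasion for an abstract family of bundles of trajectories

The half-line `[0, ∞)` of times is `ℝ≥0`. -/

section Abstract

variable {X : Type*} [TopologicalSpace X]

/-- The first time at which the graph of the trajectory `x` meets the target `M`
(`⊤` if it never does). -/
def hittingTime (M : Set (ℝ≥0 × X)) (x : C(ℝ≥0, X)) : ℝ≥0∞ :=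
  sInf ((fun t : ℝ≥0 => (t : ℝ≥0∞)) '' {t : ℝ≥0 | (t, x t) ∈ M} ∪ {⊤})

/-- The value `C_M`: one player chooses a bundle `Φ ∈ V` so as to delay the meeting with `M`, the
other one then chooses a trajectory `x ∈ Φ` so as to meet `M` as early as possible. -/
def value (V : Set (Set C(ℝ≥0, X))) (M : Set (ℝ≥0 × X)) : ℝ≥0∞ :=
  ⨆ Φ ∈ V, ⨅ x ∈ Φ, hittingTime M x

/-- The value `C_M = ∞` is exact: some bundle evades `M` on the whole half-line. -/
def IsExact (V : Set (Set C(ℝ≥0, X))) (M : Set (ℝ≥0 × X)) : Prop :=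
  ∃ Φ ∈ V, ∀ x ∈ Φ, ∀ t : ℝ≥0, (t, x t) ∉ M

/-- The value `C_M = ∞` is robust: it stays infinite for some closed neighbourhood of `M`. -/
def IsRobust (V : Set (Set C(ℝ≥0, X))) (M : Set (ℝ≥0 × X)) : Prop :=
  ∃ M' : Set (ℝ≥0 × X), IsClosed M' ∧ M ⊆ interior M' ∧ value V M' = ⊤

end Abstract

/-! ### Programmed generalized controls and the trajectories they generate -/

section Controls

/-- Lebesgue measure on the half-line `[0, ∞)`. -/
def lebesgue : Measure ℝ≥0 := Measure.comap ((↑) : ℝ≥0 → ℝ) volume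

theorem lebesgue_apply (s : Set ℝ≥0) : lebesgue s = volume (((↑) : ℝ≥0 → ℝ) '' s) :=
  (MeasurableEmbedding.subtype_coe (measurableSet_Ici (a := (0 : ℝ)))).comap_apply volume s

variable {X P Q : Type*} [NormedAddCommGroup X] [NormedSpace ℝ X]
  [TopologicalSpace P] [MeasurableSpace P] [TopologicalSpace Q] [MeasurableSpace Q]

/-- Regular Borel measures on `[0, ∞) × Z` with Lebesgue projection on compact sets of times. -/
def generalizedControls (Z : Type*) [TopologicalSpace Z] [MeasurableSpace Z] :
    Set (Measure (ℝ≥0 × Z)) :=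
  {η | η.Regular ∧ ∀ I : Set ℝ≥0, IsCompact I → η (I ×ˢ univ) = lebesgue I}

/-- The measures `η` on `[0, ∞) × P × Q`, with Lebesgue projection, consistent with the measure `ν`
on `[0, ∞) × Q`. -/
def consistentControls (P : Type*) [TopologicalSpace P] [MeasurableSpace P]
    (ν : Measure (ℝ≥0 × Q)) : Set (Measure (ℝ≥0 × P × Q)) :=
  {η | η ∈ generalizedControls (P × Q) ∧
    ∀ (I : Set ℝ≥0) (A : Set Q), MeasurableSet I → MeasurableSet A →
      η (I ×ˢ ((univ : Set P) ×ˢ A)) = ν (I ×ˢ A)}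

/-- `x` solves `x(t) = x₀ + ∫_{[0,t] × P × Q} f(τ, x(τ), u, v) dη` for all `t ≥ 0`. -/
def IsTrajectory (f : ℝ≥0 × X × P × Q → X) (x₀ : X) (η : Measure (ℝ≥0 × P × Q))
    (x : C(ℝ≥0, X)) : Prop :=
  ∀ t : ℝ≥0, x t = x₀ + ∫ z in Icc 0 t ×ˢ (univ : Set (P × Q)),
    f (z.1, x z.1, z.2.1, z.2.2) ∂η

/-- All trajectories generated by the measures consistent with `ν`. -/
def bundle (f : ℝ≥0 × X × P × Q → X) (x₀ : X) (ν : Measure (ℝ≥0 × Q)) : Set C(ℝ≥0, X) :=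
  {x | ∃ η ∈ consistentControls P ν, IsTrajectory f x₀ η x}

/-- The family `V` of the bundles of all measures `ν` on `[0, ∞) × Q` with Lebesgue projection. -/
def bundles (f : ℝ≥0 × X × P × Q → X) (x₀ : X) : Set (Set C(ℝ≥0, X)) :=
  bundle f x₀ '' generalizedControls Q

end Controls

end

end PursuitEvasion

/-!
A generalized control is a measure on `[0, ∞) × Z`, `Z` compact, that projects onto Lebesgue
measure. Two facts carry the equivalence: for a fixed `ν` the bundle of `ν` is compact, and the
bundle depends lower semicontinuously on `ν`.

Controls are compact for vague convergence (`exists_vagueTendsto`: an ultrafilter limit of positive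
functionals is represented by a measure), and because they all project onto Lebesgue measure, the
integral over `[0, t] × Z` passes to vague limits although the indicator of `[0, t]` jumps
(`VagueTendsto.tendsto_setIntegral`). The growth condition bounds trajectories on bounded intervals
uniformly in the control, so they are equi-Lipschitz there, and with Arzelà–Ascoli a family of
trajectories converges along an ultrafilter to a trajectory of the limit control
(`exists_tendsto_isDelayedTrajectory`). Applied to solutions of the equation with a vanishing delay,
for which Picard iteration becomes stationary on bounded intervals, this gives existence. The
Lipschitz condition gives uniqueness, hence the trajectory depends continuously on the control
(`tendsto_of_vagueTendsto`).

Exact implies robust: the set of points reached from the bundle of `ν` is closed by compactness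
(`isClosed_graphs_bundle`) and disjoint from `M`, so normality of `[0, ∞) × X` separates them.

Robust implies exact: choose `ν n` whose bundle avoids the neighbourhood `M'` up to time `n`, and
let `ν` be a vague limit. If a trajectory of a control `η` consistent with `ν` met `M` at time `t`,
then controls consistent with `ν n` and vaguely close to `η` would have trajectories that meet `M'`
at time `t`, for arbitrarily large `n`. Such controls exist by
`exists_vagueTendsto_consistentControls`: cut `η` into small pieces by a continuous partition of
unity `ψ` of `[0, ∞) × Q` and replace the conditional distribution of the `P`-component on the
`j`-th piece by its mean `ρ j` there. The result `∑ j, (ψ j ν) ⊗ ρ j` is close to `η`, and, the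
weights being continuous, `∑ j, (ψ j (ν n)) ⊗ ρ j` converges to it.
-/

namespace PursuitEvasion

open Filter
open scoped Topology CompactlySupported


/-! ### Lebesgue measure on the half-line and measures that project onto it -/

theorem lebesgue_Icc (s t : ℝ≥0) : lebesgue (Icc s t) = ENNReal.ofReal (t - s) := by
  have h : ((↑) : ℝ≥0 → ℝ) '' Icc s t = Icc (s : ℝ) t := by
    ext r
    refine ⟨?_, fun h => ⟨⟨r, s.2.trans h.1⟩, ⟨h.1, h.2⟩, rfl⟩⟩
    rintro ⟨u, hu, rfl⟩
    exact ⟨hu.1, hu.2⟩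
  rw [lebesgue_apply, h, Real.volume_Icc]

instance : NullSingletonClass lebesgue := ⟨fun t => by simp [lebesgue_apply]⟩

instance : IsFiniteMeasureOnCompacts lebesgue := ⟨fun K hK => by
  rw [lebesgue_apply]
  exact (hK.image NNReal.continuous_coe).measure_lt_top⟩

section Marginal

variable {Z : Type*} [MetricSpace Z] [CompactSpace Z] [MeasurableSpace Z] [BorelSpace Z]

theorem subset_Icc_prod_univ_of_isCompact {Z : Type*} [TopologicalSpace Z] {K : Set (ℝ≥0 × Z)}
    (hK : IsCompact K) : ∃ T : ℝ≥0, K ⊆ Icc 0 T ×ˢ univ := by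
  obtain ⟨T, hT⟩ := (hK.image continuous_fst).bddAbove
  exact ⟨T, fun p hp => ⟨⟨zero_le, hT ⟨p, hp, rfl⟩⟩, trivial⟩⟩

/-- The regularity required of a generalized control is automatic, and it is enough to know its
projection to the half-line. -/
theorem mem_generalizedControls_iff {η : Measure (ℝ≥0 × Z)} :
    η ∈ generalizedControls Z ↔ η.map Prod.fst = lebesgue := by
  constructor
  · rintro ⟨-, h⟩
    have happ (I : Set ℝ≥0) (hI : IsCompact I) : η.map Prod.fst I = lebesgue I := by
      rw [Measure.map_apply measurable_fst hI.measurableSet, ← h I hI, prod_univ]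
    have : IsFiniteMeasureOnCompacts (η.map Prod.fst) :=
      ⟨fun K hK => by rw [happ K hK]; exact hK.measure_lt_top⟩
    ext A hA
    rw [hA.measure_eq_iSup_isCompact, hA.measure_eq_iSup_isCompact]
    simp +contextual [happ]
  · intro h
    have happ (I : Set ℝ≥0) (hI : IsCompact I) : η (I ×ˢ univ) = lebesgue I := by
      rw [← h, Measure.map_apply measurable_fst hI.measurableSet, prod_univ]
    have : IsFiniteMeasureOnCompacts η := ⟨fun K hK => by
      obtain ⟨T, hT⟩ := subset_Icc_prod_univ_of_isCompact hK
      refine (measure_mono hT).trans_lt ?_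
      rw [happ _ isCompact_Icc]
      exact isCompact_Icc.measure_lt_top⟩
    exact ⟨inferInstance, happ⟩

theorem generalizedControls_prod_univ {η : Measure (ℝ≥0 × Z)} (hη : η ∈ generalizedControls Z)
    {I : Set ℝ≥0} (hI : MeasurableSet I) : η (I ×ˢ univ) = lebesgue I := by
  rw [← mem_generalizedControls_iff.1 hη, Measure.map_apply measurable_fst hI, prod_univ]

theorem setLIntegral_fst {η : Measure (ℝ≥0 × Z)} (hη : η ∈ generalizedControls Z)
    {I : Set ℝ≥0} (hI : MeasurableSet I) {g : ℝ≥0 → ℝ≥0∞}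
    (hg : AEMeasurable g (lebesgue.restrict I)) :
    ∫⁻ z in I ×ˢ univ, g z.1 ∂η = ∫⁻ τ in I, g τ ∂lebesgue := by
  have h : (η.restrict (I ×ˢ univ)).map Prod.fst = lebesgue.restrict I := by
    rw [← mem_generalizedControls_iff.1 hη, Measure.restrict_map measurable_fst hI, prod_univ]
  rw [← h] at hg ⊢
  rw [lintegral_map' hg measurable_fst.aemeasurable]

theorem integrableOn_Icc_prod_univ {G : Type*} [NormedAddCommGroup G] {η : Measure (ℝ≥0 × Z)}
    (hη : η ∈ generalizedControls Z) {g : ℝ≥0 × Z → G} (hg : Continuous g) (s t : ℝ≥0) :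
    IntegrableOn g (Icc s t ×ˢ univ) η := by
  have := hη.1
  exact hg.continuousOn.integrableOn_compact (isCompact_Icc.prod isCompact_univ)

theorem norm_setIntegral_prod_univ_le {G : Type*} [NormedAddCommGroup G] [NormedSpace ℝ G]
    {η : Measure (ℝ≥0 × Z)} (hη : η ∈ generalizedControls Z) {g : ℝ≥0 × Z → G} {I : Set ℝ≥0}
    (hI : MeasurableSet I) (hI' : lebesgue I ≠ ∞) {C : ℝ}
    (hg : ∀ τ ∈ I, ∀ z, ‖g (τ, z)‖ ≤ C) :
    ‖∫ z in I ×ˢ univ, g z ∂η‖ ≤ C * (lebesgue I).toReal := by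
  have hη' := generalizedControls_prod_univ hη hI
  rw [← hη', ← measureReal_def]
  exact norm_setIntegral_le_of_norm_le_const (hη' ▸ hI'.lt_top) fun z hz => hg z.1 hz.1 z.2

theorem norm_setIntegral_Icc_prod_univ_le {G : Type*} [NormedAddCommGroup G] [NormedSpace ℝ G]
    {η : Measure (ℝ≥0 × Z)} (hη : η ∈ generalizedControls Z) {g : ℝ≥0 × Z → G} {t : ℝ≥0}
    {C : ℝ} (hg : ∀ τ ∈ Icc 0 t, ∀ z, ‖g (τ, z)‖ ≤ C) :
    ‖∫ z in Icc 0 t ×ˢ univ, g z ∂η‖ ≤ C * t := by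
  have h := norm_setIntegral_prod_univ_le hη measurableSet_Icc (by simp [lebesgue_Icc]) hg
  simpa [lebesgue_Icc] using h

theorem norm_setIntegral_Ioc_prod_univ_le {G : Type*} [NormedAddCommGroup G] [NormedSpace ℝ G]
    {η : Measure (ℝ≥0 × Z)} (hη : η ∈ generalizedControls Z) {g : ℝ≥0 × Z → G} {s t : ℝ≥0}
    (hst : s ≤ t) {C : ℝ} (hg : ∀ τ ∈ Ioc s t, ∀ z, ‖g (τ, z)‖ ≤ C) :
    ‖∫ z in Ioc s t ×ˢ univ, g z ∂η‖ ≤ C * (t - s) := by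
  have hI : lebesgue (Ioc s t) = ENNReal.ofReal (t - s) := by
    rw [← lebesgue_Icc, measure_congr Ioc_ae_eq_Icc]
  have h := norm_setIntegral_prod_univ_le hη measurableSet_Ioc (by simp [hI]) hg
  rwa [hI, ENNReal.toReal_ofReal (sub_nonneg.2 (by exact_mod_cast hst))] at h

omit [MetricSpace Z] [CompactSpace Z] [BorelSpace Z] in
/-- Cutting off at `s` and at `t` differs by the integral over the slab `(s, t]`. -/
theorem setIntegral_Icc_prod_univ_sub {G : Type*} [NormedAddCommGroup G] [NormedSpace ℝ G]
    {η : Measure (ℝ≥0 × Z)} {g : ℝ≥0 × Z → G} {s t : ℝ≥0} (hst : s ≤ t)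
    (hg : IntegrableOn g (Icc 0 t ×ˢ univ) η) :
    ∫ z in Icc 0 t ×ˢ univ, g z ∂η - ∫ z in Icc 0 s ×ˢ univ, g z ∂η =
      ∫ z in Ioc s t ×ˢ univ, g z ∂η := by
  have hu : Icc 0 t ×ˢ (univ : Set Z) = Icc 0 s ×ˢ univ ∪ Ioc s t ×ˢ univ := by
    rw [← union_prod, Icc_union_Ioc_eq_Icc zero_le hst]
  rw [hu] at hg ⊢
  rw [setIntegral_union _ (measurableSet_Ioc.prod .univ) hg.left_of_union hg.right_of_union,
    add_sub_cancel_left]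
  rw [Set.disjoint_prod]
  left
  rw [Set.disjoint_left]
  exact fun x hx hx' => hx'.1.not_ge hx.2

theorem mem_consistentControls_iff {P Q : Type*} [MetricSpace P] [CompactSpace P]
    [MeasurableSpace P] [BorelSpace P] [MetricSpace Q] [CompactSpace Q] [MeasurableSpace Q]
    [BorelSpace Q] {ν : Measure (ℝ≥0 × Q)} (hν : ν ∈ generalizedControls Q)
    {η : Measure (ℝ≥0 × P × Q)} :
    η ∈ consistentControls P ν ↔ η.map (fun z => (z.1, z.2.2)) = ν := by
  have hm : Measurable fun z : ℝ≥0 × P × Q => (z.1, z.2.2) := by fun_prop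
  have happ (I : Set ℝ≥0) (A : Set Q) (hI : MeasurableSet I) (hA : MeasurableSet A) :
      η.map (fun z => (z.1, z.2.2)) (I ×ˢ A) = η (I ×ˢ ((univ : Set P) ×ˢ A)) := by
    rw [Measure.map_apply hm (hI.prod hA)]
    congr 1
    ext z
    simp
  constructor
  · rintro ⟨hη, h⟩
    symm
    refine Measure.FiniteSpanningSetsIn.ext (C := image2 (· ×ˢ ·) {s | MeasurableSet s}
      {t | MeasurableSet t}) generateFrom_prod.symm isPiSystem_prod
      ⟨fun n : ℕ => Icc 0 (n : ℝ≥0) ×ˢ univ,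
        fun n => ⟨Icc 0 (n : ℝ≥0), measurableSet_Icc (a := (0 : ℝ≥0)) (b := n), univ,
          MeasurableSet.univ, rfl⟩, fun n => ?_, ?_⟩ ?_
    · rw [generalizedControls_prod_univ hν measurableSet_Icc]
      exact isCompact_Icc.measure_lt_top
    · refine eq_univ_of_forall fun p => mem_iUnion.2 ?_
      obtain ⟨n, hn⟩ := exists_nat_ge p.1
      exact ⟨n, ⟨zero_le, hn⟩, trivial⟩
    · rintro _ ⟨I, hI, A, hA, rfl⟩
      dsimp only
      rw [happ I A hI hA, h I A hI hA]
  · intro h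
    refine ⟨?_, fun I A hI hA => by rw [← happ I A hI hA, h]⟩
    rw [mem_generalizedControls_iff] at hν ⊢
    rw [← hν, ← h, Measure.map_map measurable_fst hm]
    rfl

end Marginal

/-! ### Vague convergence of generalized controls -/

section Vague

variable {Z : Type*} [MetricSpace Z] [CompactSpace Z] [MeasurableSpace Z] [BorelSpace Z]
  {ι : Type*} {l : Filter ι}

/-- Vague convergence of measures on `[0, ∞) × Z` along a filter: convergence of the integrals of
continuous functions that vanish for large times. For compact `Z` these are exactly the continuous
functions with compact support. -/
def VagueTendsto (l : Filter ι) (η : ι → Measure (ℝ≥0 × Z)) (μ : Measure (ℝ≥0 × Z)) : Prop :=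
  ∀ (g : C(ℝ≥0 × Z, ℝ)) (K : ℝ≥0), (∀ p : ℝ≥0 × Z, K < p.1 → g p = 0) →
    Tendsto (fun i => ∫ p, g p ∂η i) l (𝓝 (∫ p, g p ∂μ))

omit [MeasurableSpace Z] [BorelSpace Z] in
theorem hasCompactSupport_of_forall_lt {g : ℝ≥0 × Z → ℝ} {K : ℝ≥0}
    (hg : ∀ p : ℝ≥0 × Z, K < p.1 → g p = 0) : HasCompactSupport g :=
  HasCompactSupport.of_support_subset_isCompact
    ((isCompact_Icc (a := 0) (b := K)).prod isCompact_univ)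
    fun p hp => ⟨⟨zero_le, not_lt.1 fun h => hp (hg p h)⟩, trivial⟩

theorem exists_forall_lt_eq_zero {Z : Type*} [TopologicalSpace Z] {g : ℝ≥0 × Z → ℝ}
    (hg : HasCompactSupport g) : ∃ K : ℝ≥0, ∀ p : ℝ≥0 × Z, K < p.1 → g p = 0 := by
  obtain ⟨K, hK⟩ := subset_Icc_prod_univ_of_isCompact hg
  exact ⟨K, fun p hp => image_eq_zero_of_notMem_tsupport fun h => hp.not_ge (hK h).1.2⟩

theorem integral_eq_setIntegral_Icc {Z : Type*} [MeasurableSpace Z] {η : Measure (ℝ≥0 × Z)}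
    {g : ℝ≥0 × Z → ℝ} {K : ℝ≥0} (hg : ∀ p : ℝ≥0 × Z, K < p.1 → g p = 0) :
    ∫ p, g p ∂η = ∫ p in Icc 0 K ×ˢ univ, g p ∂η := by
  refine (setIntegral_eq_integral_of_forall_compl_eq_zero fun p hp => hg p ?_).symm
  by_contra h
  exact hp ⟨⟨zero_le, not_lt.1 h⟩, trivial⟩

/-- Generalized controls are vaguely compact: an ultrafilter limit of the functionals
`g ↦ ∫ g ∂η i` is positive, hence represented by a measure. -/
theorem exists_vagueTendsto (U : Ultrafilter ι) {η : ι → Measure (ℝ≥0 × Z)}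
    (hη : ∀ i, η i ∈ generalizedControls Z) :
    ∃ μ ∈ generalizedControls Z, VagueTendsto U η μ := by
  have hfin (i : ι) : (η i).Regular := (hη i).1
  have hint (i : ι) (g : C_c(ℝ≥0 × Z, ℝ)) : Integrable g (η i) :=
    g.continuous.integrable_of_hasCompactSupport g.hasCompactSupport
  have hlim (g : C_c(ℝ≥0 × Z, ℝ)) : ∃ c : ℝ, Tendsto (fun i => ∫ p, g p ∂η i) U (𝓝 c) := by
    obtain ⟨K, hK⟩ := exists_forall_lt_eq_zero g.hasCompactSupport
    obtain ⟨C, hC⟩ := g.hasCompactSupport.exists_bound_of_continuous g.continuous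
    have hb (i : ι) : ∫ p, g p ∂η i ∈ Metric.closedBall (0 : ℝ) (C * K) := by
      rw [mem_closedBall_zero_iff, integral_eq_setIntegral_Icc hK]
      exact norm_setIntegral_Icc_prod_univ_le (hη i) fun τ _ z => hC _
    obtain ⟨c, -, hc⟩ := (isCompact_closedBall (0 : ℝ) (C * K)).ultrafilter_le_nhds
      (U.map fun i => ∫ p, g p ∂η i) (by
        rw [le_principal_iff]
        exact Filter.mem_map.2 (Eventually.of_forall hb))
    exact ⟨c, hc⟩
  choose Λ hΛ using hlim
  let Λ' : C_c(ℝ≥0 × Z, ℝ) →ₗ[ℝ] ℝ :=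
    { toFun := Λ
      map_add' := fun g h => tendsto_nhds_unique (hΛ (g + h)) (by
        refine ((hΛ g).add (hΛ h)).congr fun i => ?_
        rw [← integral_add (hint i g) (hint i h)]
        rfl)
      map_smul' := fun c g => tendsto_nhds_unique (hΛ (c • g)) (by
        refine ((hΛ g).const_mul c).congr fun i => ?_
        rw [← integral_const_mul]
        rfl) }
  let L : C_c(ℝ≥0 × Z, ℝ) →ₚ[ℝ] ℝ := PositiveLinearMap.mk₀ Λ' fun g hg =>
    ge_of_tendsto' (hΛ g) fun i => integral_nonneg fun p => hg p
  have hμ (g : C_c(ℝ≥0 × Z, ℝ)) : ∫ p, g p ∂(RealRMK.rieszMeasure L) = Λ g :=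
    RealRMK.integral_rieszMeasure L g
  have hreg : (RealRMK.rieszMeasure L).Regular := inferInstance
  refine ⟨RealRMK.rieszMeasure L, ?_, fun g K hg => ?_⟩
  · rw [mem_generalizedControls_iff]
    have : IsFiniteMeasureOnCompacts ((RealRMK.rieszMeasure L).map Prod.fst) := ⟨fun K hK => by
      rw [Measure.map_apply measurable_fst hK.measurableSet, ← prod_univ]
      exact (hK.prod isCompact_univ).measure_lt_top⟩
    refine Measure.ext_of_integral_eq_on_compactlySupported fun g => ?_
    obtain ⟨K, hK⟩ := g.hasCompactSupport.bddAbove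
    have hsupp : HasCompactSupport fun p : ℝ≥0 × Z => g p.1 :=
      hasCompactSupport_of_forall_lt (K := K) fun p hp =>
        image_eq_zero_of_notMem_tsupport fun h => hp.not_ge (hK h)
    let g' : C_c(ℝ≥0 × Z, ℝ) := ⟨⟨fun p => g p.1, by fun_prop⟩, hsupp⟩
    have hmap (θ : Measure (ℝ≥0 × Z)) : ∫ τ, g τ ∂θ.map Prod.fst = ∫ p, g' p ∂θ :=
      integral_map measurable_fst.aemeasurable g.continuous.aestronglyMeasurable
    rw [hmap, hμ g']
    refine tendsto_nhds_unique (hΛ g') (tendsto_const_nhds.congr fun i => ?_)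
    rw [← hmap, mem_generalizedControls_iff.1 (hη i)]
  · have := hΛ ⟨g, hasCompactSupport_of_forall_lt hg⟩
    rw [← hμ] at this
    exact this

/-- The projection of a vague limit is the vague limit of the projections. -/
theorem map_eq_of_vagueTendsto {Z' : Type*} [MetricSpace Z'] [CompactSpace Z']
    [MeasurableSpace Z'] [BorelSpace Z'] [NeBot l] {η : ι → Measure (ℝ≥0 × Z)}
    {μ : Measure (ℝ≥0 × Z)} (hμ : μ ∈ generalizedControls Z) (h : VagueTendsto l η μ) {π : Z → Z'}
    (hπ : Continuous π) {ν : Measure (ℝ≥0 × Z')} (hν : ν ∈ generalizedControls Z')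
    (hη : ∀ i, (η i).map (fun z => (z.1, π z.2)) = ν) : μ.map (fun z => (z.1, π z.2)) = ν := by
  have hc : Continuous fun z : ℝ≥0 × Z => (z.1, π z.2) := by fun_prop
  have hm := hc.measurable
  have hμ' : μ.map (fun z => (z.1, π z.2)) ∈ generalizedControls Z' := by
    rw [mem_generalizedControls_iff] at hμ ⊢
    rw [Measure.map_map measurable_fst hm, ← hμ]
    rfl
  have := hμ'.1
  have := hν.1
  refine Measure.ext_of_integral_eq_on_compactlySupported fun g => ?_
  obtain ⟨K, hK⟩ := exists_forall_lt_eq_zero g.hasCompactSupport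
  refine (integral_map hm.aemeasurable g.continuous.aestronglyMeasurable).trans ?_
  refine tendsto_nhds_unique (h ⟨fun z => g (z.1, π z.2), by fun_prop⟩ K fun p hp => hK _ hp)
    (tendsto_const_nhds.congr fun i => ?_)
  rw [← hη i]
  exact integral_map hm.aemeasurable g.continuous.aestronglyMeasurable

/-- The jump of the indicator of `[0, t]` is harmless for vague convergence, because the limit
projects onto Lebesgue measure; moreover the integrands may vary, locally uniformly. -/
theorem VagueTendsto.tendsto_setIntegral {η : ι → Measure (ℝ≥0 × Z)} {μ : Measure (ℝ≥0 × Z)}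
    (h : VagueTendsto l η μ) (hη : ∀ i, η i ∈ generalizedControls Z)
    (hμ : μ ∈ generalizedControls Z) {G : ι → C(ℝ≥0 × Z, ℝ)} {g : C(ℝ≥0 × Z, ℝ)}
    (hG : Tendsto G l (𝓝 g)) (t : ℝ≥0) :
    Tendsto (fun i => ∫ z in Icc 0 t ×ˢ univ, G i z ∂η i) l
      (𝓝 (∫ z in Icc 0 t ×ˢ univ, g z ∂μ)) := by
  have hcomp (s : ℝ≥0) : IsCompact (Icc 0 s ×ˢ (univ : Set Z)) := isCompact_Icc.prod isCompact_univ
  obtain ⟨C, hC⟩ := (hcomp (t + 1)).exists_bound_of_continuousOn g.continuous.continuousOn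
  -- A continuous cutoff which differs from the indicator of `[0, t]` on `(t, t + ε)` only.
  have key (ε : ℝ≥0) (hε : 0 < ε) (hε1 : ε ≤ 1) : ∃ χ : C(ℝ≥0 × Z, ℝ),
      (∀ p : ℝ≥0 × Z, t + ε < p.1 → χ p = 0) ∧ ∀ θ ∈ generalizedControls Z,
        |∫ z, χ z ∂θ - ∫ z in Icc 0 t ×ˢ univ, g z ∂θ| ≤ |C| * ε := by
    let χ : C(ℝ≥0 × Z, ℝ) :=
      ⟨fun p => g p * max 0 (min 1 (1 - ((p.1 : ℝ) - t) / ε)), by fun_prop⟩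
    have hχ0 (p : ℝ≥0 × Z) (hp : t + ε < p.1) : χ p = 0 := by
      have hp' : (t : ℝ) + ε < p.1 := by exact_mod_cast hp
      have : 1 - ((p.1 : ℝ) - t) / ε ≤ 0 := by
        rw [sub_nonpos, le_div_iff₀ (by exact_mod_cast hε)]
        linarith
      change g p * max 0 (min 1 (1 - ((p.1 : ℝ) - t) / ε)) = 0
      rw [max_eq_left ((min_le_right _ _).trans this), mul_zero]
    refine ⟨χ, hχ0, fun θ hθ => ?_⟩
    have hχg : ∫ z in Icc 0 t ×ˢ univ, g z ∂θ = ∫ z in Icc 0 t ×ˢ univ, χ z ∂θ := by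
      refine setIntegral_congr_fun (measurableSet_Icc.prod .univ) fun p hp => ?_
      have hp' : (p.1 : ℝ) ≤ t := by exact_mod_cast hp.1.2
      have : 1 ≤ 1 - ((p.1 : ℝ) - t) / ε := by
        have : ((p.1 : ℝ) - t) / ε ≤ 0 := div_nonpos_of_nonpos_of_nonneg (by linarith) ε.2
        linarith
      change g p = g p * max 0 (min 1 (1 - ((p.1 : ℝ) - t) / ε))
      rw [min_eq_left this, max_eq_right zero_le_one, mul_one]
    rw [integral_eq_setIntegral_Icc hχ0, hχg, setIntegral_Icc_prod_univ_sub le_self_add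
      (integrableOn_Icc_prod_univ hθ χ.continuous 0 _)]
    have hb := norm_setIntegral_Ioc_prod_univ_le hθ (g := χ) (s := t) (t := t + ε) (C := |C|)
      le_self_add fun τ hτ z => by
        have h1 : ‖g (τ, z)‖ ≤ |C| := (hC (τ, z)
          ⟨⟨zero_le, hτ.2.trans (by gcongr)⟩, trivial⟩).trans (le_abs_self C)
        change ‖g (τ, z) * max 0 (min 1 (1 - ((τ : ℝ) - t) / ε))‖ ≤ |C|
        rw [norm_mul]
        refine (mul_le_of_le_one_right (norm_nonneg _) ?_).trans h1
        rw [Real.norm_of_nonneg (le_max_left _ _)]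
        exact max_le zero_le_one (min_le_left _ _)
    rwa [NNReal.coe_add, add_sub_cancel_left] at hb
  rw [Metric.tendsto_nhds]
  intro δ hδ
  obtain ⟨ε, hε, hε1, hεδ⟩ : ∃ ε : ℝ≥0, 0 < ε ∧ ε ≤ 1 ∧ |C| * ε ≤ δ / 4 := by
    have hq : 0 < δ / (4 * (|C| + 1)) := by positivity
    refine ⟨min 1 (δ / (4 * (|C| + 1))).toNNReal, lt_min one_pos (Real.toNNReal_pos.2 hq),
      min_le_left _ _, ?_⟩
    calc |C| * ((min 1 (δ / (4 * (|C| + 1))).toNNReal : ℝ≥0) : ℝ)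
        ≤ (|C| + 1) * (δ / (4 * (|C| + 1))) := by
          refine mul_le_mul (by linarith) ?_ NNReal.zero_le_coe (by positivity)
          exact (NNReal.coe_le_coe.2 (min_le_right _ _)).trans_eq (Real.coe_toNNReal _ hq.le)
      _ = δ / 4 := by field_simp
  obtain ⟨χ, hχ0, hχ⟩ := key ε hε hε1
  obtain ⟨κ, hκ, hκδ⟩ : ∃ κ : ℝ, 0 < κ ∧ κ * t ≤ δ / 4 := by
    refine ⟨δ / (4 * (t + 1)), by positivity, ?_⟩
    calc δ / (4 * (t + 1)) * t ≤ δ / (4 * (t + 1)) * (t + 1) := by gcongr; linarith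
      _ = δ / 4 := by field_simp
  have hunif := Metric.tendstoUniformlyOn_iff.1
    (ContinuousMap.tendsto_iff_forall_isCompact_tendstoUniformlyOn.1 hG _ (hcomp t)) κ hκ
  filter_upwards [hunif, Metric.tendsto_nhds.1 (h χ (t + ε) hχ0) (δ / 4) (by positivity)]
    with i hi hi'
  have h1 := norm_setIntegral_Icc_prod_univ_le (hη i) (g := fun p => G i p - g p)
    (C := κ) fun τ hτ z => by
      have := hi (τ, z) ⟨hτ, trivial⟩
      rw [dist_comm, dist_eq_norm] at this
      exact this.le
  rw [integral_sub (integrableOn_Icc_prod_univ (hη i) (G i).continuous _ _)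
    (integrableOn_Icc_prod_univ (hη i) g.continuous _ _), Real.norm_eq_abs] at h1
  have h2 := hχ _ (hη i)
  have h3 := hχ _ hμ
  rw [Real.dist_eq] at hi' ⊢
  rw [abs_le] at h1 h2 h3
  rw [abs_lt] at hi' ⊢
  constructor <;> linarith

end Vague


/-! ### A Gronwall estimate with an integrable weight -/

/-- A Gronwall inequality in which the weight `g` is merely integrable. On time intervals so short
that the weight has integral at most `1 / 2`, the running maximum of `φ` at most doubles; `N` is the
number of such intervals needed to cover `[0, T]`, so that it does not depend on `φ`. -/
theorem exists_forall_le_two_pow_mul {g : ℝ≥0 → ℝ≥0∞} {T : ℝ≥0}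
    (hg : ∫⁻ τ in Icc 0 T, g τ ∂lebesgue ≠ ∞) :
    ∃ N : ℕ, ∀ φ : ℝ≥0 → ℝ, Continuous φ → (∀ t, 0 ≤ φ t) →
      (∀ (s t : ℝ≥0) (B : ℝ), s ≤ t → t ≤ T → (∀ τ ≤ t, φ τ ≤ B) →
        φ t ≤ φ s + B * (∫⁻ τ in Ioc s t, g τ ∂lebesgue).toReal) →
      ∀ t ≤ T, φ t ≤ 2 ^ N * φ 0 := by
  obtain ⟨δ, hδ, hδg⟩ := exists_pos_setLIntegral_lt_of_measure_lt hg
    (ε := ENNReal.ofReal (1 / 2)) (by simp)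
  obtain ⟨d, hd, hdδ⟩ : ∃ d : ℝ≥0, 0 < d ∧ (d : ℝ≥0∞) < δ := ENNReal.lt_iff_exists_nnreal_btwn.1 hδ
    |>.imp fun d hd => ⟨by exact_mod_cast hd.1, hd.2⟩
  have hshort (s t : ℝ≥0) (htT : t ≤ T) (hts : t ≤ s + d) :
      (∫⁻ τ in Ioc s t, g τ ∂lebesgue).toReal ≤ 1 / 2 := by
    have hsub : Ioc s t ⊆ Icc 0 T := fun τ hτ => ⟨zero_le, hτ.2.trans htT⟩
    have h := hδg (Ioc s t) ((Measure.restrict_apply_le _ _).trans_lt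
      ((measure_mono Ioc_subset_Icc_self).trans_lt (lt_of_le_of_lt ?_ hdδ)))
    · rw [Measure.restrict_restrict measurableSet_Ioc, inter_eq_left.2 hsub] at h
      have := ENNReal.toReal_mono ENNReal.ofReal_ne_top h.le
      rwa [ENNReal.toReal_ofReal (by norm_num)] at this
    · rw [lebesgue_Icc, ← ENNReal.ofReal_coe_nnreal]
      refine ENNReal.ofReal_le_ofReal ?_
      have : (t : ℝ) ≤ s + d := by exact_mod_cast hts
      linarith
  obtain ⟨N, hN⟩ := exists_nat_ge (T / d)
  have hNT : T ≤ N * d := by rwa [div_le_iff₀ hd] at hN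
  refine ⟨N, fun φ hφ hφ0 h t ht => ?_⟩
  have key (j : ℕ) : ∀ t ≤ T, t ≤ j * d → φ t ≤ 2 ^ j * φ 0 := by
    induction j with
    | zero =>
      intro t _ ht
      rw [Nat.cast_zero, zero_mul] at ht
      rw [le_antisymm ht zero_le]
      simp
    | succ j ih =>
      intro t htT htj
      obtain ⟨m, hm, hmax⟩ := (isCompact_Icc (a := 0) (b := t)).exists_isMaxOn
        ⟨t, zero_le, le_rfl⟩ hφ.continuousOn
      have hmT := hm.2.trans htT
      have hs := ih (min m (j * d)) ((min_le_left _ _).trans hmT) (min_le_right _ _)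
      have hmd : m ≤ min m (j * d) + d := by
        rw [min_add]
        refine le_min le_self_add (hm.2.trans (htj.trans_eq ?_))
        push_cast
        ring
      have h1 := h (min m (j * d)) m (φ m) (min_le_left _ _) hmT
        fun τ hτ => hmax ⟨zero_le, hτ.trans hm.2⟩
      have h2 := mul_le_mul_of_nonneg_left (hshort (min m (j * d)) m hmT hmd) (hφ0 m)
      have h3 : φ t ≤ φ m := hmax ⟨zero_le, le_rfl⟩
      rw [pow_succ]
      linarith
  exact key N t ht (ht.trans hNT)

section Trajectories

variable {X : Type*} [NormedAddCommGroup X] [NormedSpace ℝ X]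
  {Z : Type*} [MetricSpace Z] [CompactSpace Z] [MeasurableSpace Z] [BorelSpace Z]
  {f : ℝ≥0 × X × Z → X} {x₀ : X} {a : ℝ≥0 → ℝ}

theorem norm_setIntegral_Ioc_prod_univ_le_lintegral {η : Measure (ℝ≥0 × Z)}
    (hη : η ∈ generalizedControls Z) {g : ℝ≥0 × Z → X} {b : ℝ≥0 → ℝ} {s t : ℝ≥0} {B : ℝ}
    (hb : IntegrableOn b (Ioc s t) lebesgue) (hB : 0 ≤ B)
    (hg : ∀ τ ∈ Ioc s t, ∀ z, ‖g (τ, z)‖ ≤ b τ * B) :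
    ‖∫ z in Ioc s t ×ˢ univ, g z ∂η‖ ≤ B * (∫⁻ τ in Ioc s t, ‖b τ‖ₑ ∂lebesgue).toReal := by
  have h1 : ∫⁻ z in Ioc s t ×ˢ univ, ‖g z‖ₑ ∂η ≤
      ENNReal.ofReal B * ∫⁻ τ in Ioc s t, ‖b τ‖ₑ ∂lebesgue := by
    rw [← setLIntegral_fst hη measurableSet_Ioc hb.aestronglyMeasurable.enorm,
      ← lintegral_const_mul' _ _ ENNReal.ofReal_ne_top]
    refine setLIntegral_mono' (measurableSet_Ioc.prod .univ) fun z hz => ?_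
    rw [← ofReal_norm, ← ofReal_norm, ← ENNReal.ofReal_mul hB]
    refine ENNReal.ofReal_le_ofReal ((hg z.1 hz.1 z.2).trans ?_)
    rw [mul_comm]
    exact mul_le_mul_of_nonneg_left (le_abs_self _) hB
  have h2 := (enorm_integral_le_lintegral_enorm g).trans h1
  have h3 := ENNReal.toReal_mono (ENNReal.mul_ne_top ENNReal.ofReal_ne_top hb.2.ne) h2
  rwa [toReal_enorm, ENNReal.toReal_mul, ENNReal.toReal_ofReal hB] at h3

/-- Solutions of the retarded equation `x(t) = x₀ + ∫_{[0,t] × Z} f(τ, x(τ - h), z) dη`, where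
`x` is extended to negative times by `x(0)` (the subtraction in `ℝ≥0` is truncated). -/
def IsDelayedTrajectory (f : ℝ≥0 × X × Z → X) (x₀ : X) (η : Measure (ℝ≥0 × Z)) (h : ℝ≥0)
    (x : C(ℝ≥0, X)) : Prop :=
  ∀ t : ℝ≥0, x t = x₀ + ∫ z in Icc 0 t ×ˢ univ, f (z.1, x (z.1 - h), z.2) ∂η

namespace IsDelayedTrajectory

variable {η : Measure (ℝ≥0 × Z)} {h : ℝ≥0} {x : C(ℝ≥0, X)}

theorem apply_zero (hη : η ∈ generalizedControls Z) (hx : IsDelayedTrajectory f x₀ η h x) :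
    x 0 = x₀ := by
  have h0 : η (Icc 0 0 ×ˢ univ) = 0 := by
    rw [generalizedControls_prod_univ hη measurableSet_Icc]
    simp
  rw [hx 0, setIntegral_measure_zero _ h0, add_zero]

theorem sub_eq (hx : IsDelayedTrajectory f x₀ η h x) (hf : Continuous f)
    (hη : η ∈ generalizedControls Z) {s t : ℝ≥0} (hst : s ≤ t) :
    x t - x s = ∫ z in Ioc s t ×ˢ univ, f (z.1, x (z.1 - h), z.2) ∂η := by
  have hc : Continuous fun z : ℝ≥0 × Z => f (z.1, x (z.1 - h), z.2) := by fun_prop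
  rw [← setIntegral_Icc_prod_univ_sub hst (integrableOn_Icc_prod_univ hη hc 0 t), hx t, hx s,
    add_sub_add_left_eq_sub]

end IsDelayedTrajectory

/-- The linear growth condition bounds all delayed trajectories, uniformly in the control and in the
delay. -/
theorem exists_norm_le_of_isDelayedTrajectory (hf : Continuous f)
    (ha : LocallyIntegrable a lebesgue)
    (hfa : ∀ (t : ℝ≥0) (x : X) (z : Z), ‖f (t, x, z)‖ ≤ a t * (1 + ‖x‖)) (x₀ : X) (T : ℝ≥0) :
    ∃ R : ℝ, ∀ η ∈ generalizedControls Z, ∀ (h : ℝ≥0) (x : C(ℝ≥0, X)),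
      IsDelayedTrajectory f x₀ η h x → ∀ t ≤ T, ‖x t‖ ≤ R := by
  have haT : IntegrableOn a (Icc 0 T) lebesgue := ha.integrableOn_isCompact isCompact_Icc
  obtain ⟨N, hN⟩ := exists_forall_le_two_pow_mul (g := fun τ => ‖a τ‖ₑ) haT.2.ne
  refine ⟨2 ^ N * (1 + ‖x₀‖), fun η hη h x hx t ht => ?_⟩
  have key := hN (fun τ => 1 + ‖x τ‖) (by fun_prop) (fun τ => by positivity) ?_ t ht
  · rw [hx.apply_zero hη] at key
    linarith
  · intro s t B hst htT hB
    have hB0 : 0 ≤ B := (by positivity : 0 ≤ 1 + ‖x t‖).trans (hB t le_rfl)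
    have h1 := norm_setIntegral_Ioc_prod_univ_le_lintegral hη
      (g := fun z => f (z.1, x (z.1 - h), z.2)) (s := s) (haT.mono_set fun τ hτ => ⟨zero_le, hτ.2.trans htT⟩) hB0 fun τ hτ z => by
        have hnn := (norm_nonneg _).trans (hfa τ 0 z)
        rw [norm_zero, add_zero, mul_one] at hnn
        exact (hfa _ _ _).trans
          (mul_le_mul_of_nonneg_left (hB _ (tsub_le_self.trans hτ.2)) hnn)
    rw [← hx.sub_eq hf hη hst] at h1
    have h2 := norm_le_norm_add_norm_sub' (x t) (x s)
    linarith

/-- Delayed trajectories are locally Lipschitz, uniformly in the control and in the delay. -/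
theorem exists_norm_sub_le_of_isDelayedTrajectory [FiniteDimensional ℝ X] (hf : Continuous f)
    (ha : LocallyIntegrable a lebesgue)
    (hfa : ∀ (t : ℝ≥0) (x : X) (z : Z), ‖f (t, x, z)‖ ≤ a t * (1 + ‖x‖)) (x₀ : X) (T : ℝ≥0) :
    ∃ C : ℝ, ∀ η ∈ generalizedControls Z, ∀ (h : ℝ≥0) (x : C(ℝ≥0, X)),
      IsDelayedTrajectory f x₀ η h x → ∀ s t, s ≤ t → t ≤ T → ‖x t - x s‖ ≤ C * (t - s) := by
  obtain ⟨R, hR⟩ := exists_norm_le_of_isDelayedTrajectory hf ha hfa x₀ T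
  obtain ⟨C, hC⟩ := ((isCompact_Icc (a := 0) (b := T)).prod
    ((isCompact_closedBall (0 : X) R).prod
      (isCompact_univ (X := Z)))).exists_bound_of_continuousOn hf.continuousOn
  refine ⟨C, fun η hη h x hx s t hst htT => ?_⟩
  rw [hx.sub_eq hf hη hst]
  refine norm_setIntegral_Ioc_prod_univ_le hη hst fun τ hτ z =>
    hC _ ⟨⟨zero_le, hτ.2.trans htT⟩, ?_, trivial⟩
  rw [mem_closedBall_zero_iff]
  exact hR η hη h x hx _ (tsub_le_self.trans (hτ.2.trans htT))

omit [NormedSpace ℝ X] in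
theorem dist_le_of_norm_sub_le {y : ℝ≥0 → X} {C : ℝ} {T : ℝ≥0}
    (h : ∀ s t, s ≤ t → t ≤ T → ‖y t - y s‖ ≤ C * (t - s)) {s t : ℝ≥0} (hs : s ≤ T) (ht : t ≤ T) :
    dist (y t) (y s) ≤ C * dist t s := by
  wlog hst : s ≤ t generalizing s t
  · rw [dist_comm, dist_comm t]
    exact this ht hs (not_le.1 hst).le
  rw [dist_eq_norm, NNReal.dist_eq, abs_of_nonneg (sub_nonneg.2 (NNReal.coe_le_coe.2 hst))]
  exact h s t hst ht

theorem tendsto_mul_dist_nhds_zero (C : ℝ) (t : ℝ≥0) :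
    Tendsto (fun s => C * dist s t) (𝓝 t) (𝓝 0) := by
  have : Tendsto (fun s => C * dist s t) (𝓝 t) (𝓝 (C * dist t t)) :=
    Continuous.tendsto (by fun_prop) t
  rwa [dist_self, mul_zero] at this

omit [NormedSpace ℝ X] in
theorem continuous_of_norm_sub_le {y : ℝ≥0 → X}
    (h : ∀ T : ℝ≥0, ∃ C : ℝ, ∀ s t, s ≤ t → t ≤ T → ‖y t - y s‖ ≤ C * (t - s)) : Continuous y :=
  continuous_iff_continuousAt.2 fun t => by
    obtain ⟨C, hC⟩ := h (t + 1)
    exact tendsto_iff_dist_tendsto_zero.2 (squeeze_zero' (Eventually.of_forall fun _ => dist_nonneg)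
      ((eventually_lt_nhds (lt_add_one t)).mono fun s hs =>
        dist_le_of_norm_sub_le hC le_self_add hs.le) (tendsto_mul_dist_nhds_zero C t))

/-- Arzelà–Ascoli for locally bounded and locally equi-Lipschitz families. -/
theorem exists_tendsto_of_equiLipschitz [FiniteDimensional ℝ X] {ι : Type*} (U : Ultrafilter ι)
    {x : ι → C(ℝ≥0, X)} (hR : ∀ T : ℝ≥0, ∃ R : ℝ, ∀ i, ∀ t ≤ T, ‖x i t‖ ≤ R)
    (hC : ∀ T : ℝ≥0, ∃ C : ℝ, ∀ i, ∀ s t, s ≤ t → t ≤ T → ‖x i t - x i s‖ ≤ C * (t - s)) :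
    ∃ y : C(ℝ≥0, X), Tendsto x U (𝓝 y) := by
  have hlim (t : ℝ≥0) : ∃ c : X, Tendsto (fun i => x i t) U (𝓝 c) := by
    obtain ⟨R, hR⟩ := hR t
    obtain ⟨c, -, hc⟩ := (isCompact_closedBall (0 : X) R).ultrafilter_le_nhds
      (U.map fun i => x i t) (by
        rw [le_principal_iff]
        exact Filter.mem_map.2 (Eventually.of_forall fun i =>
          mem_closedBall_zero_iff.2 (hR i t le_rfl)))
    exact ⟨c, hc⟩
  choose y hy using hlim
  have hCy (T : ℝ≥0) (C : ℝ) (hC : ∀ i, ∀ s t, s ≤ t → t ≤ T → ‖x i t - x i s‖ ≤ C * (t - s)) :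
      ∀ s t, s ≤ t → t ≤ T → ‖y t - y s‖ ≤ C * (t - s) := fun s t hst ht =>
    le_of_tendsto' ((hy t).sub (hy s)).norm fun i => hC i s t hst ht
  have hcont : Continuous y := continuous_of_norm_sub_le fun T => (hC T).imp fun C hC => hCy T C hC
  refine ⟨⟨y, hcont⟩, ContinuousMap.tendsto_iff_tendstoLocallyUniformly.2
    (Metric.tendstoLocallyUniformly_iff.2 fun ε hε t => ?_)⟩
  obtain ⟨C, hC⟩ := hC (t + 1)
  have hlt : ∀ᶠ s in 𝓝 t, s ≤ t + 1 :=
    (eventually_lt_nhds (lt_add_one t)).mono fun s hs => hs.le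
  have hd := (tendsto_mul_dist_nhds_zero C t).eventually_lt_const
    (by positivity : 0 < ε / 3)
  refine ⟨_, hlt.and hd, ?_⟩
  filter_upwards [Metric.tendsto_nhds.1 (hy t) (ε / 3) (by positivity)] with i hi s hs
  have h1 := dist_le_of_norm_sub_le (hC i) (s := t) (t := s) le_self_add hs.1
  have h2 := dist_le_of_norm_sub_le (hCy _ C hC) (s := t) (t := s) le_self_add hs.1
  have h3 := dist_triangle4 (y s) (y t) (x i t) (x i s)
  rw [dist_comm (x i t) (x i s)] at h3
  rw [dist_comm] at hi
  change dist (y s) (x i s) < ε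
  linarith [hs.2]

/-- The set of trajectories is closed under vague convergence of the controls and vanishing
delays. -/
theorem isDelayedTrajectory_of_tendsto [FiniteDimensional ℝ X] {ι : Type*} {l : Filter ι}
    [NeBot l] (hf : Continuous f)
    {η : ι → Measure (ℝ≥0 × Z)} (hη : ∀ i, η i ∈ generalizedControls Z) {μ : Measure (ℝ≥0 × Z)}
    (hμ : μ ∈ generalizedControls Z) (hημ : VagueTendsto l η μ) {h : ι → ℝ≥0} {h' : ℝ≥0}
    (hh : Tendsto h l (𝓝 h')) {x : ι → C(ℝ≥0, X)} {y : C(ℝ≥0, X)} (hxy : Tendsto x l (𝓝 y))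
    (hx : ∀ i, IsDelayedTrajectory f x₀ (η i) (h i) (x i)) : IsDelayedTrajectory f x₀ μ h' y := by
  have : CompleteSpace X := FiniteDimensional.complete ℝ X
  intro t
  rw [← sub_eq_iff_eq_add']
  refine (SeparatingDual.eq_iff_forall_dual_eq (R := ℝ)).2 fun φ => ?_
  let Ψ : ℝ≥0 × C(ℝ≥0, X) → C(ℝ≥0 × Z, ℝ) := fun p =>
    ⟨fun z => φ (f (z.1, p.2 (z.1 - p.1), z.2)), φ.continuous.comp (hf.comp (by fun_prop))⟩
  have hΨ : Continuous Ψ := ContinuousMap.continuous_of_continuous_uncurry _ <|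
    φ.continuous.comp (hf.comp (by fun_prop))
  have hint (η : Measure (ℝ≥0 × Z)) (hη : η ∈ generalizedControls Z) (p : ℝ≥0 × C(ℝ≥0, X)) :
      φ (∫ z in Icc 0 t ×ˢ univ, f (z.1, p.2 (z.1 - p.1), z.2) ∂η) =
        ∫ z in Icc 0 t ×ˢ univ, Ψ p z ∂η :=
    (φ.integral_comp_comm (integrableOn_Icc_prod_univ hη (hf.comp (by fun_prop)) 0 t)).symm
  rw [hint μ hμ (h', y)]
  have h1 := hημ.tendsto_setIntegral hη hμ ((hΨ.tendsto (h', y)).comp (hh.prodMk_nhds hxy)) t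
  refine tendsto_nhds_unique ?_ h1
  have h2 : Tendsto (fun i => φ (x i t - x₀)) l (𝓝 (φ (y t - x₀))) :=
    (Continuous.tendsto (by fun_prop : Continuous fun y : C(ℝ≥0, X) => φ (y t - x₀)) y).comp hxy
  refine h2.congr fun i => ?_
  rw [hx i t, add_sub_cancel_left, hint _ (hη i) (h i, x i)]
  rfl

end Trajectories


/-! ### Existence, uniqueness and continuous dependence of trajectories -/

section Trajectories

variable {X : Type*} [NormedAddCommGroup X] [NormedSpace ℝ X] [FiniteDimensional ℝ X]
  {Z : Type*} [MetricSpace Z] [CompactSpace Z] [MeasurableSpace Z] [BorelSpace Z]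
  {f : ℝ≥0 × X × Z → X} {x₀ : X} {a : ℝ≥0 → ℝ}

omit [FiniteDimensional ℝ X] in
theorem continuous_setIntegral_Icc_prod_univ {η : Measure (ℝ≥0 × Z)}
    (hη : η ∈ generalizedControls Z) {g : ℝ≥0 × Z → X} (hg : Continuous g) :
    Continuous fun t => ∫ z in Icc 0 t ×ˢ univ, g z ∂η :=
  continuous_of_norm_sub_le fun T => by
    obtain ⟨C, hC⟩ := ((isCompact_Icc (a := 0) (b := T)).prod
      (isCompact_univ (X := Z))).exists_bound_of_continuousOn hg.continuousOn
    refine ⟨C, fun s t hst ht => ?_⟩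
    rw [setIntegral_Icc_prod_univ_sub hst (integrableOn_Icc_prod_univ hη hg 0 t)]
    exact norm_setIntegral_Ioc_prod_univ_le hη hst fun τ hτ z =>
      hC _ ⟨⟨zero_le, hτ.2.trans ht⟩, trivial⟩

omit [FiniteDimensional ℝ X] in
/-- For a positive delay the Picard iteration becomes stationary on every bounded interval of
times, whence existence of delayed trajectories. -/
theorem exists_isDelayedTrajectory_of_pos (hf : Continuous f) (x₀ : X) {η : Measure (ℝ≥0 × Z)}
    (hη : η ∈ generalizedControls Z) {h : ℝ≥0} (hh : 0 < h) :
    ∃ x : C(ℝ≥0, X), IsDelayedTrajectory f x₀ η h x := by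
  let Γ : C(ℝ≥0, X) → C(ℝ≥0, X) := fun x =>
    ⟨fun t => x₀ + ∫ z in Icc 0 t ×ˢ univ, f (z.1, x (z.1 - h), z.2) ∂η,
      continuous_const.add (continuous_setIntegral_Icc_prod_univ hη (by fun_prop))⟩
  let u : ℕ → C(ℝ≥0, X) := fun n => Γ^[n] (ContinuousMap.const _ x₀)
  have hu (n : ℕ) : u (n + 1) = Γ (u n) := Function.iterate_succ_apply' _ _ _
  have hΓ (x y : C(ℝ≥0, X)) (t : ℝ≥0) (hxy : ∀ τ ≤ t - h, x τ = y τ) : Γ x t = Γ y t := by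
    change x₀ + _ = x₀ + _
    congr 1
    refine setIntegral_congr_fun (measurableSet_Icc.prod .univ) fun z hz => ?_
    rw [hxy _ (tsub_le_tsub_right hz.1.2 h)]
  have hstep (n : ℕ) : ∀ t ≤ n * h, u (n + 1) t = u n t := by
    induction n with
    | zero =>
      intro t ht
      rw [Nat.cast_zero, zero_mul] at ht
      obtain rfl : t = 0 := le_antisymm ht zero_le
      have h0 : η (Icc 0 0 ×ˢ univ) = 0 := by
        rw [generalizedControls_prod_univ hη measurableSet_Icc]
        simp
      rw [hu]
      change x₀ + ∫ z in Icc 0 0 ×ˢ univ, f (z.1, u 0 (z.1 - h), z.2) ∂η = x₀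
      rw [setIntegral_measure_zero _ h0, add_zero]
    | succ n ih =>
      intro t ht
      rw [hu (n + 1), hu n]
      refine hΓ _ _ _ fun τ hτ => ?_
      rw [← hu n]
      refine ih τ (hτ.trans (tsub_le_iff_right.2 (ht.trans_eq ?_)))
      push_cast
      ring
  have hstat (n m : ℕ) (hnm : n ≤ m) : ∀ t ≤ n * h, u m t = u n t := by
    induction m, hnm using Nat.le_induction with
    | base => exact fun _ _ => rfl
    | succ m hnm ih =>
      intro t ht
      rw [hstep m t (ht.trans (by gcongr)), ih t ht]
  let N : ℝ≥0 → ℕ := fun t => ⌈t / h⌉₊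
  have hN (t : ℝ≥0) : t ≤ N t * h := (div_le_iff₀ hh).1 (Nat.le_ceil _)
  have hux (n : ℕ) (t : ℝ≥0) (ht : t ≤ n * h) : u n t = u (N t) t := by
    rcases le_total n (N t) with h' | h'
    · exact (hstat _ _ h' t ht).symm
    · exact hstat _ _ h' t (hN t)
  have hcont : Continuous fun t => u (N t) t := continuous_iff_continuousAt.2 fun t => by
    refine ((u (N (t + 1))).continuous.continuousAt (x := t)).congr ?_
    filter_upwards [eventually_lt_nhds (lt_add_one t)] with s hs
    exact hux _ _ (hs.le.trans (hN (t + 1)))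
  refine ⟨⟨fun t => u (N t) t, hcont⟩, fun t => ?_⟩
  change u (N t) t = _
  rw [← hux (N t + 1) t ((hN t).trans (by gcongr; simp)), hu]
  exact hΓ _ ⟨fun t => u (N t) t, hcont⟩ _ fun τ hτ =>
    hux _ _ ((hτ.trans tsub_le_self).trans (hN t))

/-- Trajectories of vaguely convergent controls subconverge to a trajectory of the limit. -/
theorem exists_tendsto_isDelayedTrajectory {ι : Type*} (U : Ultrafilter ι) (hf : Continuous f)
    (ha : LocallyIntegrable a lebesgue)
    (hfa : ∀ (t : ℝ≥0) (x : X) (z : Z), ‖f (t, x, z)‖ ≤ a t * (1 + ‖x‖))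
    {η : ι → Measure (ℝ≥0 × Z)} (hη : ∀ i, η i ∈ generalizedControls Z) {μ : Measure (ℝ≥0 × Z)}
    (hμ : μ ∈ generalizedControls Z) (hημ : VagueTendsto U η μ) {h : ι → ℝ≥0} {h' : ℝ≥0}
    (hh : Tendsto h U (𝓝 h')) {x : ι → C(ℝ≥0, X)}
    (hx : ∀ i, IsDelayedTrajectory f x₀ (η i) (h i) (x i)) :
    ∃ y : C(ℝ≥0, X), Tendsto x U (𝓝 y) ∧ IsDelayedTrajectory f x₀ μ h' y := by
  obtain ⟨y, hy⟩ := exists_tendsto_of_equiLipschitz U (x := x)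
    (fun T => (exists_norm_le_of_isDelayedTrajectory hf ha hfa x₀ T).imp
      fun R hR i => hR _ (hη i) _ _ (hx i))
    (fun T => (exists_norm_sub_le_of_isDelayedTrajectory hf ha hfa x₀ T).imp
      fun C hC i => hC _ (hη i) _ _ (hx i))
  exact ⟨y, hy, isDelayedTrajectory_of_tendsto hf hη hμ hημ hh hy hx⟩

/-- Existence of trajectories, by letting the delay tend to zero. -/
theorem exists_isDelayedTrajectory_zero (hf : Continuous f)
    (ha : LocallyIntegrable a lebesgue)
    (hfa : ∀ (t : ℝ≥0) (x : X) (z : Z), ‖f (t, x, z)‖ ≤ a t * (1 + ‖x‖)) (x₀ : X)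
    {η : Measure (ℝ≥0 × Z)} (hη : η ∈ generalizedControls Z) :
    ∃ x : C(ℝ≥0, X), IsDelayedTrajectory f x₀ η 0 x := by
  have hpos (n : ℕ) : (0 : ℝ≥0) < 1 / ((n : ℝ≥0) + 1) := by positivity
  choose x hx using fun n : ℕ => exists_isDelayedTrajectory_of_pos hf x₀ hη (hpos n)
  obtain ⟨y, -, hy⟩ := exists_tendsto_isDelayedTrajectory (hyperfilter ℕ) hf ha hfa
    (fun _ => hη) hη (fun _ _ _ => tendsto_const_nhds)
    ((tendsto_one_div_add_atTop_nhds_zero_nat (𝕜 := ℝ≥0)).mono_left Nat.hyperfilter_le_atTop) hx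
  exact ⟨y, hy⟩

omit [FiniteDimensional ℝ X] in
/-- Uniqueness of trajectories. -/
theorem IsDelayedTrajectory.eq_of_zero (hf : Continuous f)
    (hf_lip : ∀ A : Set (ℝ≥0 × X), IsCompact A → ∃ L : ℝ≥0 → ℝ, Integrable L lebesgue ∧
      ∀ (t : ℝ≥0) (x₁ x₂ : X), (t, x₁) ∈ A → (t, x₂) ∈ A →
        ∀ z : Z, ‖f (t, x₁, z) - f (t, x₂, z)‖ ≤ L t * ‖x₁ - x₂‖)
    {η : Measure (ℝ≥0 × Z)} (hη : η ∈ generalizedControls Z) {x y : C(ℝ≥0, X)}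
    (hx : IsDelayedTrajectory f x₀ η 0 x) (hy : IsDelayedTrajectory f x₀ η 0 y) : x = y := by
  ext T
  obtain ⟨L, hL, hfL⟩ := hf_lip
    ((fun t => (t, x t)) '' Icc 0 T ∪ (fun t => (t, y t)) '' Icc 0 T)
    ((isCompact_Icc.image (by fun_prop)).union (isCompact_Icc.image (by fun_prop)))
  obtain ⟨N, hN⟩ := exists_forall_le_two_pow_mul (T := T) (g := fun τ => ‖|L τ|‖ₑ)
    hL.abs.integrableOn.2.ne
  have key := hN (fun τ => ‖x τ - y τ‖) (by fun_prop) (fun τ => norm_nonneg _) ?_ T le_rfl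
  · rw [hx.apply_zero hη, hy.apply_zero hη, sub_self, norm_zero, mul_zero] at key
    exact sub_eq_zero.1 (norm_le_zero_iff.1 key)
  intro s t B hst htT hB
  have hint (x : C(ℝ≥0, X)) :
      IntegrableOn (fun z : ℝ≥0 × Z => f (z.1, x (z.1 - 0), z.2)) (Ioc s t ×ˢ univ) η :=
    (integrableOn_Icc_prod_univ hη (by fun_prop) s t).mono_set
      (Set.prod_mono Ioc_subset_Icc_self le_rfl)
  -- `L` may be negative at times when the two trajectories agree, hence the absolute value.
  have h1 := norm_setIntegral_Ioc_prod_univ_le_lintegral hη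
    (g := fun z => f (z.1, x (z.1 - 0), z.2) - f (z.1, y (z.1 - 0), z.2)) (b := fun τ => |L τ|)
    (s := s) (t := t) hL.abs.integrableOn ((norm_nonneg _).trans (hB t le_rfl)) fun τ hτ z => by
      have hτT : τ ∈ Icc 0 T := ⟨zero_le, hτ.2.trans htT⟩
      dsimp only
      rw [tsub_zero]
      refine (hfL τ (x τ) (y τ) (.inl ⟨τ, hτT, rfl⟩) (.inr ⟨τ, hτT, rfl⟩) z).trans ?_
      exact mul_le_mul (le_abs_self _) (hB τ hτ.2) (norm_nonneg _) (abs_nonneg _)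
  rw [integral_sub (hint x) (hint y), ← hx.sub_eq hf hη hst, ← hy.sub_eq hf hη hst] at h1
  have h2 := norm_le_norm_add_norm_sub' (x t - y t) (x s - y s)
  rw [sub_sub_sub_comm] at h2
  linarith

/-- The trajectory depends continuously on the control. -/
theorem tendsto_of_vagueTendsto {ι : Type*} {l : Filter ι} (hf : Continuous f)
    (ha : LocallyIntegrable a lebesgue)
    (hfa : ∀ (t : ℝ≥0) (x : X) (z : Z), ‖f (t, x, z)‖ ≤ a t * (1 + ‖x‖))
    (hf_lip : ∀ A : Set (ℝ≥0 × X), IsCompact A → ∃ L : ℝ≥0 → ℝ, Integrable L lebesgue ∧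
      ∀ (t : ℝ≥0) (x₁ x₂ : X), (t, x₁) ∈ A → (t, x₂) ∈ A →
        ∀ z : Z, ‖f (t, x₁, z) - f (t, x₂, z)‖ ≤ L t * ‖x₁ - x₂‖)
    {η : ι → Measure (ℝ≥0 × Z)} (hη : ∀ i, η i ∈ generalizedControls Z) {μ : Measure (ℝ≥0 × Z)}
    (hμ : μ ∈ generalizedControls Z) (hημ : VagueTendsto l η μ) {x : ι → C(ℝ≥0, X)}
    (hx : ∀ i, IsDelayedTrajectory f x₀ (η i) 0 (x i)) {y : C(ℝ≥0, X)}
    (hy : IsDelayedTrajectory f x₀ μ 0 y) : Tendsto x l (𝓝 y) := by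
  refine tendsto_iff_ultrafilter _ _ _ |>.2 fun U hU => ?_
  obtain ⟨y', hxy', hy'⟩ := exists_tendsto_isDelayedTrajectory U hf ha hfa hη hμ
    (fun g K hg => (hημ g K hg).mono_left hU) tendsto_const_nhds hx
  rwa [hy.eq_of_zero hf hf_lip hμ hy']

end Trajectories


/-! ### Lifting a convergent sequence of controls -/

section Lift

theorem exists_isProbabilityMeasure_eq_smul {P : Type*} [MeasurableSpace P] [Nonempty P]
    (μ : Measure P) [IsFiniteMeasure μ] :
    ∃ ρ : Measure P, IsProbabilityMeasure ρ ∧ μ = μ univ • ρ := by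
  by_cases h : μ = 0
  · exact ⟨Measure.dirac (Classical.arbitrary P), inferInstance, by simp [h]⟩
  · have : NeZero μ := ⟨h⟩
    refine ⟨(μ univ)⁻¹ • μ, inferInstance, ?_⟩
    rw [smul_smul, ENNReal.mul_inv_cancel (by simpa using h) (measure_ne_top μ univ), one_smul]

/-- A finite continuous partition of unity on `[0, ∞) × Q` whose members have support either in a
ball of radius `r` or beyond the time `k`. -/
theorem exists_partitionOfUnity (Q : Type*) [MetricSpace Q] [CompactSpace Q] {r : ℝ} (hr : 0 < r)
    (k : ℝ≥0) : ∃ (s : Set (ℝ≥0 × Q)) (_ : Fintype (Option s)) (ψ : Option s → C(ℝ≥0 × Q, ℝ≥0)),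
      (∀ w, ∑ j, ψ j w = 1) ∧ (∀ (c : s) (w), ψ (some c) w ≠ 0 → dist w c < r) ∧
        ∀ w, ψ none w ≠ 0 → k < w.1 := by
  obtain ⟨s, -, hs, hcov⟩ := ((isCompact_Icc (a := (0 : ℝ≥0)) (b := k)).prod
    (isCompact_univ (X := Q))).finite_cover_balls hr
  have := hs.fintype
  let V : Option s → Set (ℝ≥0 × Q) := fun j =>
    j.elim {w | k < w.1} fun c => Metric.ball (c : ℝ≥0 × Q) r
  have hV : ∀ j, IsOpen (V j)
    | none => isOpen_lt continuous_const continuous_fst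
    | some c => Metric.isOpen_ball
  have hVcov : (univ : Set (ℝ≥0 × Q)) ⊆ ⋃ j, V j := fun w _ => by
    rcases le_or_gt w.1 k with h | h
    · obtain ⟨c, hc, hw⟩ := mem_iUnion₂.1 (hcov ⟨⟨zero_le, h⟩, trivial⟩ : w ∈ _)
      exact mem_iUnion.2 ⟨some ⟨c, hc⟩, hw⟩
    · exact mem_iUnion.2 ⟨none, h⟩
  obtain ⟨ψ, hψ⟩ := PartitionOfUnity.exists_isSubordinate isClosed_univ V hV hVcov
  have hsub (j : Option s) (w : ℝ≥0 × Q) (hw : (ψ j w).toNNReal ≠ 0) : w ∈ V j :=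
    hψ j (subset_tsupport _ fun h => hw (by rw [h, Real.toNNReal_zero]))
  refine ⟨s, inferInstance, fun j => ⟨fun w => (ψ j w).toNNReal, by fun_prop⟩, fun w => ?_,
    fun c w => hsub (some c) w, fun w => hsub none w⟩
  have h1 := ψ.sum_eq_one (mem_univ w)
  rw [finsum_eq_sum_of_fintype] at h1
  change ∑ j, (ψ j w).toNNReal = 1
  rw [← Real.toNNReal_sum_of_nonneg fun j _ => ψ.nonneg j w, h1, Real.toNNReal_one]

variable {P Q : Type*} [MetricSpace P] [CompactSpace P] [MeasurableSpace P] [BorelSpace P]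
  [MetricSpace Q] [CompactSpace Q] [MeasurableSpace Q] [BorelSpace Q]

/-- Two measures that split into finitely many pieces, located pairwise in a common ball in
`[0, ∞) × Q` and with a common projection to `P`, are close to each other: on each piece compare the
test function with its value at the centre of the ball. -/
theorem abs_integral_sub_integral_le_of_pieces {J : Type*} [Fintype J]
    {ξ θ : J → Measure (ℝ≥0 × P × Q)} (hξ : ∑ j, ξ j ∈ generalizedControls (P × Q))
    (hθ : ∑ j, θ j ∈ generalizedControls (P × Q)) {g : C(ℝ≥0 × P × Q, ℝ)} {K : ℝ≥0}
    (hg : ∀ p : ℝ≥0 × P × Q, K < p.1 → g p = 0) {r ω : ℝ} (hr : r ≤ 1) (hω0 : 0 ≤ ω)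
    (hω : ∀ (w w' : ℝ≥0 × Q) (u : P), dist w w' < r → |g (w.1, u, w.2) - g (w'.1, u, w'.2)| ≤ ω)
    (h : ∀ j, (g =ᵐ[ξ j] 0 ∧ g =ᵐ[θ j] 0) ∨
      ∃ c : ℝ≥0 × Q, (ξ j).map (fun z => z.2.1) = (θ j).map (fun z => z.2.1) ∧
        (∀ᵐ z ∂ξ j, dist (z.1, z.2.2) c < r) ∧ ∀ᵐ z ∂θ j, dist (z.1, z.2.2) c < r) :
    |∫ z, g z ∂∑ j, ξ j - ∫ z, g z ∂∑ j, θ j| ≤ 2 * ω * (K + 1) := by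
  set S : Set (ℝ≥0 × P × Q) := Icc 0 (K + 1) ×ˢ univ with hS
  have hSc : IsCompact S := isCompact_Icc.prod isCompact_univ
  have hle (ξ : J → Measure (ℝ≥0 × P × Q)) (j : J) : ξ j ≤ ∑ j, ξ j :=
    Finset.single_le_sum (fun _ _ => Measure.zero_le _) (Finset.mem_univ j)
  have hsum {ξ : J → Measure (ℝ≥0 × P × Q)} (hξ : ∑ j, ξ j ∈ generalizedControls (P × Q)) :
      ∑ j, (ξ j).real S = K + 1 := by
    have h1 : ∑ j, ξ j S = ENNReal.ofReal (K + 1) := by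
      rw [← Measure.finsetSum_apply, hS, generalizedControls_prod_univ hξ measurableSet_Icc,
        lebesgue_Icc]
      simp
    simp only [measureReal_def]
    rw [← ENNReal.toReal_sum, h1, ENNReal.toReal_ofReal (by positivity)]
    intro j _ hj
    rw [ENNReal.sum_eq_top.2 ⟨j, Finset.mem_univ j, hj⟩] at h1
    simp at h1
  have hlt {ξ : J → Measure (ℝ≥0 × P × Q)} (hξ : ∑ j, ξ j ∈ generalizedControls (P × Q)) (j : J) :
      IsFiniteMeasureOnCompacts (ξ j) := by
    have := hξ.1
    exact ⟨fun C hC => (hle ξ j C).trans_lt hC.measure_lt_top⟩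
  have hint {ξ : J → Measure (ℝ≥0 × P × Q)} (hξ : ∑ j, ξ j ∈ generalizedControls (P × Q)) (j : J) :
      Integrable g (ξ j) := by
    have := hlt hξ j
    exact g.continuous.integrable_of_hasCompactSupport (hasCompactSupport_of_forall_lt hg)
  have hpiece {ξ : J → Measure (ℝ≥0 × P × Q)} (hξ : ∑ j, ξ j ∈ generalizedControls (P × Q)) (j : J)
      (c : ℝ≥0 × Q) (hc : ∀ᵐ z ∂ξ j, dist (z.1, z.2.2) c < r) :
      |∫ z, g z ∂ξ j - ∫ z, g (c.1, z.2.1, c.2) ∂ξ j| ≤ ω * (ξ j).real S := by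
    have := hlt hξ j
    -- Beyond the time `K + 1` the test function vanishes at the centre of the ball as well, since
    -- `r ≤ 1`; this keeps the error proportional to the mass of `S`.
    have hfar : ∀ᵐ z ∂ξ j, z ∉ S → g (c.1, z.2.1, c.2) = 0 := by
      filter_upwards [hc] with z hz hzS
      refine hg _ ?_
      have h1 : dist z.1 c.1 < 1 := ((le_max_left _ _).trans_lt hz).trans_le hr
      have h2 : K + 1 < z.1 := by
        by_contra hcon
        exact hzS ⟨⟨zero_le, not_lt.1 hcon⟩, trivial⟩
      rw [NNReal.dist_eq] at h1
      have h3 : (K : ℝ) + 1 < z.1 := by exact_mod_cast h2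
      have h4 := (abs_lt.1 h1).2
      change K < c.1
      rw [← NNReal.coe_lt_coe]
      linarith
    have hnear : ∫ z, g z ∂ξ j = ∫ z in S, g z ∂ξ j :=
      integral_eq_setIntegral_Icc fun p hp => hg p (lt_of_le_of_lt le_self_add hp)
    rw [hnear, ← setIntegral_eq_integral_of_ae_compl_eq_zero hfar, ← integral_sub
      (g.continuous.continuousOn.integrableOn_compact hSc)
      ((by fun_prop : Continuous fun z : ℝ≥0 × P × Q => g (c.1, z.2.1, c.2)).continuousOn
        |>.integrableOn_compact hSc)]
    rw [← Real.norm_eq_abs]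
    refine norm_setIntegral_le_of_norm_le_const_ae hSc.measure_lt_top ?_
    exact (ae_restrict_of_ae hc).mono fun z hz => hω (z.1, z.2.2) c z.2.1 hz
  rw [integral_finsetSum_measure fun j _ => hint hξ j,
    integral_finsetSum_measure fun j _ => hint hθ j, ← Finset.sum_sub_distrib]
  have hj (j : J) : |∫ z, g z ∂ξ j - ∫ z, g z ∂θ j| ≤ ω * (ξ j).real S + ω * (θ j).real S := by
    rcases h j with ⟨h1, h2⟩ | ⟨c, hmap, h1, h2⟩
    · rw [integral_congr_ae h1, integral_congr_ae h2]
      simp only [Pi.zero_apply, integral_zero, sub_zero, abs_zero]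
      positivity
    · have h3 := hpiece hξ j c h1
      have h4 := hpiece hθ j c h2
      have hcm : Measurable fun z : ℝ≥0 × P × Q => z.2.1 := by fun_prop
      have hgc : Continuous fun u => g (c.1, u, c.2) := by fun_prop
      have h5 : ∫ z, g (c.1, z.2.1, c.2) ∂ξ j = ∫ z, g (c.1, z.2.1, c.2) ∂θ j := by
        have h6 (ζ : Measure (ℝ≥0 × P × Q)) : ∫ u, g (c.1, u, c.2) ∂ζ.map (fun z => z.2.1) =
            ∫ z, g (c.1, z.2.1, c.2) ∂ζ :=
          integral_map hcm.aemeasurable hgc.aestronglyMeasurable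
        rw [← h6, hmap, h6]
      rw [h5] at h3
      rw [abs_le] at h3 h4 ⊢
      constructor <;> linarith
  refine (Finset.abs_sum_le_sum_abs _ _).trans ((Finset.sum_le_sum fun j _ => hj j).trans_eq ?_)
  rw [Finset.sum_add_distrib, ← Finset.mul_sum, ← Finset.mul_sum, hsum hξ, hsum hθ]
  ring

end Lift


section Lift

theorem sum_withDensity_eq_self {α J : Type*} [MeasurableSpace α] [Fintype J] (μ : Measure α)
    {ψ : J → α → ℝ≥0} (hψ : ∀ j, Measurable (ψ j)) (hsum : ∀ w, ∑ j, ψ j w = 1) :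
    ∑ j, μ.withDensity (fun w => (ψ j w : ℝ≥0∞)) = μ := by
  ext A hA
  rw [Measure.finsetSum_apply]
  simp_rw [withDensity_apply _ hA]
  rw [← lintegral_finsetSum _ fun j _ => (hψ j).coe_nnreal_ennreal]
  simp_rw [← ENNReal.ofNNReal_finsetSum, hsum]
  simp

variable {P Q : Type*} [MetricSpace P] [CompactSpace P] [MeasurableSpace P] [BorelSpace P]
  [MetricSpace Q] [CompactSpace Q] [MeasurableSpace Q] [BorelSpace Q]

/-- The measure `(ψ ν) ⊗ ρ`, transported from `([0, ∞) × Q) × P` to `[0, ∞) × P × Q`. -/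
noncomputable def weightedProd (ψ : C(ℝ≥0 × Q, ℝ≥0)) (ρ : Measure P) (ν : Measure (ℝ≥0 × Q)) :
    Measure (ℝ≥0 × P × Q) :=
  ((ν.withDensity fun w => (ψ w : ℝ≥0∞)).prod ρ).map fun p => (p.1.1, p.2, p.1.2)

section WeightedProd

variable (ψ : C(ℝ≥0 × Q, ℝ≥0)) (ρ : Measure P) [IsProbabilityMeasure ρ] (ν : Measure (ℝ≥0 × Q))

omit [CompactSpace Q] [BorelSpace Q] in
theorem map_weightedProd_time_right :
    (weightedProd ψ ρ ν).map (fun z => (z.1, z.2.2)) = ν.withDensity fun w => (ψ w : ℝ≥0∞) := by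
  rw [weightedProd, Measure.map_map (by fun_prop) (by fun_prop)]
  exact Measure.map_fst_prod.trans (by rw [measure_univ, one_smul])

omit [CompactSpace Q] [BorelSpace Q] in
theorem map_weightedProd_left :
    (weightedProd ψ ρ ν).map (fun z => z.2.1) =
      (ν.withDensity fun w => (ψ w : ℝ≥0∞)) univ • ρ := by
  rw [weightedProd, Measure.map_map (by fun_prop) (by fun_prop)]
  exact Measure.map_snd_prod

theorem integral_weightedProd {ν : Measure (ℝ≥0 × Q)} (hν : ν ∈ generalizedControls Q)
    {g : C(ℝ≥0 × P × Q, ℝ)} {K : ℝ≥0} (hg : ∀ p : ℝ≥0 × P × Q, K < p.1 → g p = 0) :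
    Integrable g (weightedProd ψ ρ ν) ∧
      ∫ z, g z ∂weightedProd ψ ρ ν = ∫ w, (ψ w : ℝ) * ∫ u, g (w.1, u, w.2) ∂ρ ∂ν := by
  have := hν.1
  have : IsLocallyFiniteMeasure (ν.withDensity fun w => (ψ w : ℝ≥0∞)) :=
    IsLocallyFiniteMeasure.withDensity_coe ψ.continuous
  have he : Measurable fun p : (ℝ≥0 × Q) × P => (p.1.1, p.2, p.1.2) := by fun_prop
  have hge : Integrable (fun p : (ℝ≥0 × Q) × P => g (p.1.1, p.2, p.1.2))
      ((ν.withDensity fun w => (ψ w : ℝ≥0∞)).prod ρ) := by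
    refine Continuous.integrable_of_hasCompactSupport (by fun_prop) ?_
    refine HasCompactSupport.of_support_subset_isCompact
      (((isCompact_Icc (a := 0) (b := K)).prod isCompact_univ).prod isCompact_univ) fun p hp =>
      ⟨⟨⟨zero_le, not_lt.1 fun h => hp (hg _ h)⟩, trivial⟩, trivial⟩
  constructor
  · exact (integrable_map_measure g.continuous.aestronglyMeasurable he.aemeasurable).2 hge
  · rw [weightedProd, integral_map he.aemeasurable g.continuous.aestronglyMeasurable,
      integral_prod _ hge, integral_withDensity_eq_integral_smul ψ.continuous.measurable]
    rfl

end WeightedProd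

section Sum

variable {J : Type*} [Fintype J] (ψ : J → C(ℝ≥0 × Q, ℝ≥0))
  (ρ : J → Measure P) [∀ j, IsProbabilityMeasure (ρ j)]

theorem sum_weightedProd_mem_consistentControls (hψ : ∀ w, ∑ j, ψ j w = 1) {ν : Measure (ℝ≥0 × Q)}
    (hν : ν ∈ generalizedControls Q) :
    ∑ j, weightedProd (ψ j) (ρ j) ν ∈ consistentControls P ν := by
  rw [mem_consistentControls_iff hν,
    Measure.map_finset_sum' (Measurable.aemeasurable (by fun_prop))]
  simp_rw [map_weightedProd_time_right]
  exact sum_withDensity_eq_self ν (fun j => (ψ j).continuous.measurable) hψ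

/-- For fixed continuous weights the lift is vaguely continuous. -/
theorem vagueTendsto_sum_weightedProd {ι : Type*} {l : Filter ι} {ν : Measure (ℝ≥0 × Q)}
    (hν : ν ∈ generalizedControls Q) {νs : ι → Measure (ℝ≥0 × Q)}
    (hνs : ∀ i, νs i ∈ generalizedControls Q) (h : VagueTendsto l νs ν) :
    VagueTendsto l (fun i => ∑ j, weightedProd (ψ j) (ρ j) (νs i))
      (∑ j, weightedProd (ψ j) (ρ j) ν) := by
  intro g K hg
  have hsum {ν : Measure (ℝ≥0 × Q)} (hν : ν ∈ generalizedControls Q) :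
      ∫ z, g z ∂∑ j, weightedProd (ψ j) (ρ j) ν =
        ∑ j, ∫ w, (ψ j w : ℝ) * ∫ u, g (w.1, u, w.2) ∂(ρ j) ∂ν := by
    rw [integral_finsetSum_measure fun j _ => (integral_weightedProd (ψ j) (ρ j) hν hg).1]
    exact Finset.sum_congr rfl fun j _ => (integral_weightedProd (ψ j) (ρ j) hν hg).2
  rw [hsum hν]
  simp_rw [fun i => hsum (hνs i)]
  refine tendsto_finsetSum _ fun j _ => ?_
  have hc : Continuous fun w : ℝ≥0 × Q => ∫ u, g (w.1, u, w.2) ∂(ρ j) := by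
    have := continuous_parametric_integral_of_continuous (μ := ρ j)
      (f := fun (w : ℝ≥0 × Q) (u : P) => g (w.1, u, w.2)) (by fun_prop) isCompact_univ
    simpa only [Measure.restrict_univ] using this
  refine h ⟨fun w => (ψ j w : ℝ) * ∫ u, g (w.1, u, w.2) ∂(ρ j), by fun_prop⟩ K fun w hw => ?_
  change (ψ j w : ℝ) * ∫ u, g (w.1, u, w.2) ∂(ρ j) = 0
  have h0 (u : P) : g (w.1, u, w.2) = 0 := hg (w.1, u, w.2) hw
  simp [h0]

end Sum

/-- A control `η` consistent with `ν` is approximated by weighted products over `ν`: cut `η` with a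
fine partition of unity of `[0, ∞) × Q` and decouple the `P`-component within each piece. -/
theorem exists_sum_weightedProd_close {ν : Measure (ℝ≥0 × Q)} (hν : ν ∈ generalizedControls Q)
    {η : Measure (ℝ≥0 × P × Q)} (hη : η ∈ consistentControls P ν) {r : ℝ} (hr : 0 < r)
    (hr1 : r ≤ 1) (k : ℝ≥0) :
    ∃ (s : Set (ℝ≥0 × Q)) (_ : Fintype (Option s)) (ψ : Option s → C(ℝ≥0 × Q, ℝ≥0))
      (ρ : Option s → Measure P), (∀ w, ∑ j, ψ j w = 1) ∧ (∀ j, IsProbabilityMeasure (ρ j)) ∧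
        ∀ (g : C(ℝ≥0 × P × Q, ℝ)) (K : ℝ≥0), K ≤ k →
          (∀ p : ℝ≥0 × P × Q, K < p.1 → g p = 0) → ∀ ω : ℝ, 0 ≤ ω →
          (∀ (w w' : ℝ≥0 × Q) (u : P), dist w w' < r →
            |g (w.1, u, w.2) - g (w'.1, u, w'.2)| ≤ ω) →
          |∫ z, g z ∂∑ j, weightedProd (ψ j) (ρ j) ν - ∫ z, g z ∂η| ≤ 2 * ω * (K + 1) := by
  obtain ⟨s, hs, ψ, hsum, hnear, hfar⟩ := exists_partitionOfUnity Q hr k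
  have hne : Nonempty P := by
    by_contra hP
    rw [not_nonempty_iff] at hP
    have h1 := generalizedControls_prod_univ hη.1 (measurableSet_Icc (a := 0) (b := 1))
    rw [Measure.eq_zero_of_isEmpty η, lebesgue_Icc] at h1
    simp at h1
  have hp : Measurable fun z : ℝ≥0 × P × Q => (z.1, z.2.2) := by fun_prop
  have hu : Measurable fun z : ℝ≥0 × P × Q => z.2.1 := by fun_prop
  have hηmap := (mem_consistentControls_iff hν).1 hη
  have hψm (j : Option s) : Measurable fun w => (ψ j w : ℝ≥0∞) :=
    (ψ j).continuous.measurable.coe_nnreal_ennreal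
  let θ : Option s → Measure (ℝ≥0 × P × Q) := fun j =>
    η.withDensity fun z => (ψ j (z.1, z.2.2) : ℝ≥0∞)
  have hθsum : ∑ j, θ j = η := sum_withDensity_eq_self η
    (ψ := fun j z => ψ j (z.1, z.2.2)) (fun j => by fun_prop) fun z => hsum _
  have hθuniv (j : Option s) :
      (θ j).map (fun z => z.2.1) univ = (ν.withDensity fun w => (ψ j w : ℝ≥0∞)) univ := by
    rw [Measure.map_apply hu .univ, preimage_univ, withDensity_apply _ .univ,
      withDensity_apply _ .univ, Measure.restrict_univ, Measure.restrict_univ, ← hηmap,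
      lintegral_map (hψm j) hp]
  have hfin (c : s) : (ν.withDensity fun w => (ψ (some c) w : ℝ≥0∞)) univ ≠ ∞ := by
    have := hν.1
    have : IsLocallyFiniteMeasure (ν.withDensity fun w => (ψ (some c) w : ℝ≥0∞)) :=
      IsLocallyFiniteMeasure.withDensity_coe (ψ (some c)).continuous
    have hae : ∀ᵐ w ∂ν.withDensity fun w => (ψ (some c) w : ℝ≥0∞),
        w ∈ Icc (0 : ℝ≥0) ((c : ℝ≥0 × Q).1 + 1) ×ˢ (univ : Set Q) := by
      rw [ae_withDensity_iff (hψm _)]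
      refine Eventually.of_forall fun w hw => ⟨⟨zero_le, ?_⟩, trivial⟩
      have h1 : dist w.1 (c : ℝ≥0 × Q).1 < 1 := ((le_max_left _ _).trans_lt
        (hnear c w (by simpa using hw))).trans_le hr1
      rw [NNReal.dist_eq] at h1
      have h2 := (abs_lt.1 h1).2
      rw [← NNReal.coe_le_coe, NNReal.coe_add, NNReal.coe_one]
      linarith
    rw [← measure_eq_measure_of_null_sdiff (subset_univ _) (by
      rw [← compl_eq_univ_sdiff]; exact hae)]
    exact (isCompact_Icc.prod isCompact_univ).measure_lt_top.ne
  have hρ (j : Option s) : ∃ ρ : Measure P, IsProbabilityMeasure ρ ∧ (j ≠ none →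
      (θ j).map (fun z => z.2.1) = (ν.withDensity fun w => (ψ j w : ℝ≥0∞)) univ • ρ) := by
    cases j with
    | none => exact ⟨Measure.dirac (Classical.arbitrary P), inferInstance, fun h => (h rfl).elim⟩
    | some c =>
      have : IsFiniteMeasure ((θ (some c)).map fun z => z.2.1) :=
        ⟨by rw [hθuniv]; exact (hfin c).lt_top⟩
      obtain ⟨ρ, hρ, h⟩ := exists_isProbabilityMeasure_eq_smul
        ((θ (some c)).map fun z => z.2.1)
      exact ⟨ρ, hρ, fun _ => by rw [← hθuniv]; exact h⟩
  choose ρ hρ1 hρ2 using hρ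
  refine ⟨s, hs, ψ, ρ, hsum, hρ1, fun g K hK hg ω hω0 hω => ?_⟩
  have hξ := (sum_weightedProd_mem_consistentControls ψ ρ hsum hν).1
  have hξae (j : Option s) {p : ℝ≥0 × Q → Prop}
      (h : ∀ w, ψ j w ≠ 0 → p w) : ∀ᵐ z ∂weightedProd (ψ j) (ρ j) ν, p (z.1, z.2.2) := by
    refine ae_of_ae_map hp.aemeasurable ?_
    rw [map_weightedProd_time_right, ae_withDensity_iff (hψm j)]
    exact Eventually.of_forall fun w hw => h w (by simpa using hw)
  have hθae (j : Option s) {p : ℝ≥0 × Q → Prop}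
      (h : ∀ w, ψ j w ≠ 0 → p w) : ∀ᵐ z ∂θ j, p (z.1, z.2.2) := by
    refine (ae_withDensity_iff ((hψm j).comp hp)).2 ?_
    exact Eventually.of_forall fun z hz => h _ (by simpa using hz)
  rw [← hθsum]
  refine abs_integral_sub_integral_le_of_pieces hξ (hθsum ▸ hη.1) hg hr1 hω0 hω fun j => ?_
  cases j with
  | none =>
    exact .inl ⟨(hξae none hfar).mono fun z hz => hg z (hK.trans_lt hz),
      (hθae none hfar).mono fun z hz => hg z (hK.trans_lt hz)⟩
  | some c =>
    exact .inr ⟨c, by rw [map_weightedProd_left, hρ2 _ (Option.some_ne_none c)],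
      hξae _ (hnear c), hθae _ (hnear c)⟩

/-- Lower semicontinuity of the set of consistent controls: if `ν i → ν` vaguely, then every control
consistent with `ν` is the limit of controls `η' k`, each of which is a limit of controls consistent
with the `ν i`. -/
theorem exists_vagueTendsto_consistentControls {ι : Type*} {l : Filter ι}
    {ν : Measure (ℝ≥0 × Q)} (hν : ν ∈ generalizedControls Q) {νs : ι → Measure (ℝ≥0 × Q)}
    (hνs : ∀ i, νs i ∈ generalizedControls Q) (h : VagueTendsto l νs ν)
    {η : Measure (ℝ≥0 × P × Q)} (hη : η ∈ consistentControls P ν) :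
    ∃ (θ : ℕ → ι → Measure (ℝ≥0 × P × Q)) (η' : ℕ → Measure (ℝ≥0 × P × Q)),
      (∀ k i, θ k i ∈ consistentControls P (νs i)) ∧
      (∀ k, η' k ∈ generalizedControls (P × Q)) ∧
      (∀ k, VagueTendsto l (θ k) (η' k)) ∧ VagueTendsto atTop η' η := by
  have hr (k : ℕ) : (0 : ℝ) < 1 / ((k : ℝ) + 1) := by positivity
  have hr1 (k : ℕ) : (1 : ℝ) / ((k : ℝ) + 1) ≤ 1 := by
    rw [div_le_one (by positivity)]
    linarith [(Nat.cast_nonneg k : (0 : ℝ) ≤ k)]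
  choose s hs ψ ρ hψ hρ hclose using fun k : ℕ =>
    exists_sum_weightedProd_close hν hη (hr k) (hr1 k) k
  refine ⟨fun k i => ∑ j, weightedProd (ψ k j) (ρ k j) (νs i),
    fun k => ∑ j, weightedProd (ψ k j) (ρ k j) ν,
    fun k i => sum_weightedProd_mem_consistentControls _ _ (hψ k) (hνs i),
    fun k => (sum_weightedProd_mem_consistentControls _ _ (hψ k) hν).1,
    fun k => vagueTendsto_sum_weightedProd _ _ hν hνs h, fun g K hg => ?_⟩
  rw [Metric.tendsto_nhds]
  intro ε hε
  have hunif := (hasCompactSupport_of_forall_lt hg).uniformContinuous_of_continuous g.continuous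
  have hω : 0 < ε / (4 * (K + 1)) := by positivity
  obtain ⟨δ, hδ, hgδ⟩ := Metric.uniformContinuous_iff.1 hunif _ hω
  obtain ⟨k₀, hk₀⟩ := exists_nat_ge K
  have hsmall : ∀ᶠ k : ℕ in atTop, 1 / ((k : ℝ) + 1) < δ :=
    (tendsto_one_div_add_atTop_nhds_zero_nat (𝕜 := ℝ)).eventually_lt_const hδ
  filter_upwards [hsmall, eventually_ge_atTop k₀] with k hk hkk
  have h1 := hclose k g K (hk₀.trans (by exact_mod_cast hkk)) hg _ hω.le fun w w' u hw => by
    refine (hgδ (a := (w.1, u, w.2)) (b := (w'.1, u, w'.2)) ?_).le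
    have hww := hw.trans hk
    simp only [Prod.dist_eq, max_lt_iff, dist_self] at hww ⊢
    exact ⟨hww.1, hδ, hww.2⟩
  refine h1.trans_lt ?_
  have : 2 * (ε / (4 * (K + 1))) * ((K : ℝ) + 1) = ε / 2 := by
    field_simp
    ring
  rw [this]
  linarith

end Lift


/-! ### Exactness and robustness -/

theorem hittingTime_eq_top {X : Type*} [TopologicalSpace X] {M : Set (ℝ≥0 × X)} {x : C(ℝ≥0, X)}
    (h : ∀ t, (t, x t) ∉ M) : hittingTime M x = ⊤ := by
  simp [hittingTime, h]

theorem hittingTime_le {X : Type*} [TopologicalSpace X] {M : Set (ℝ≥0 × X)} {x : C(ℝ≥0, X)}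
    {t : ℝ≥0} (h : (t, x t) ∈ M) : hittingTime M x ≤ t :=
  sInf_le (.inl ⟨t, h, rfl⟩)

variable {X : Type*} [NormedAddCommGroup X] [NormedSpace ℝ X]
  {P Q : Type*} [MetricSpace P] [CompactSpace P] [MeasurableSpace P] [BorelSpace P]
  [MetricSpace Q] [CompactSpace Q] [MeasurableSpace Q] [BorelSpace Q]
  {f : ℝ≥0 × X × P × Q → X} {x₀ : X} {a : ℝ≥0 → ℝ}

omit [MetricSpace P] [CompactSpace P] [BorelSpace P] [MetricSpace Q] [CompactSpace Q]
  [BorelSpace Q] in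
theorem isTrajectory_iff_isDelayedTrajectory {η : Measure (ℝ≥0 × P × Q)} {x : C(ℝ≥0, X)} :
    IsTrajectory f x₀ η x ↔ IsDelayedTrajectory f x₀ η 0 x := by
  simp only [IsTrajectory, IsDelayedTrajectory, tsub_zero]

/-- The set of points reached by the trajectories of a bundle is closed. -/
theorem isClosed_graphs_bundle [FiniteDimensional ℝ X] (hf : Continuous f)
    (ha : LocallyIntegrable a lebesgue)
    (hfa : ∀ (t : ℝ≥0) (x : X) (z : P × Q), ‖f (t, x, z)‖ ≤ a t * (1 + ‖x‖))
    {ν : Measure (ℝ≥0 × Q)} (hν : ν ∈ generalizedControls Q) :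
    IsClosed {p : ℝ≥0 × X | ∃ x ∈ bundle (P := P) f x₀ ν, x p.1 = p.2} := by
  refine isClosed_of_closure_subset fun p hp => ?_
  obtain ⟨q, hq, hqp⟩ := mem_closure_iff_seq_limit.1 hp
  choose x hx hxq using hq
  choose η hη hxη using hx
  let U := hyperfilter ℕ
  obtain ⟨μ, hμ, hημ⟩ := exists_vagueTendsto U fun n => (hη n).1
  obtain ⟨y, hxy, hy⟩ := exists_tendsto_isDelayedTrajectory U hf ha hfa (fun n => (hη n).1) hμ hημ
    tendsto_const_nhds fun n => isTrajectory_iff_isDelayedTrajectory.1 (hxη n)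
  have hμν : μ ∈ consistentControls P ν := (mem_consistentControls_iff hν).2 <|
    map_eq_of_vagueTendsto hμ hημ continuous_snd hν fun n =>
      (mem_consistentControls_iff hν).1 (hη n)
  refine ⟨y, ⟨μ, hμν, isTrajectory_iff_isDelayedTrajectory.2 hy⟩, ?_⟩
  have hqU : Tendsto q U (𝓝 p) := hqp.mono_left Nat.hyperfilter_le_atTop
  have h1 : Tendsto (fun n => x n (q n).1) U (𝓝 (y p.1)) :=
    ((by fun_prop : Continuous fun r : C(ℝ≥0, X) × ℝ≥0 => r.1 r.2).tendsto (y, p.1)).comp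
      (hxy.prodMk_nhds ((continuous_fst.tendsto p).comp hqU))
  simp_rw [hxq] at h1
  exact tendsto_nhds_unique h1 ((continuous_snd.tendsto p).comp hqU)

theorem IsExact.isRobust [FiniteDimensional ℝ X] (hf : Continuous f)
    (ha : LocallyIntegrable a lebesgue)
    (hfa : ∀ (t : ℝ≥0) (x : X) (z : P × Q), ‖f (t, x, z)‖ ≤ a t * (1 + ‖x‖))
    {M : Set (ℝ≥0 × X)} (hM : IsClosed M) (h : IsExact (bundles f x₀) M) :
    IsRobust (bundles f x₀) M := by
  obtain ⟨_, ⟨ν, hν, rfl⟩, hΦ⟩ := h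
  have hdisj : M ⊆ {p : ℝ≥0 × X | ∃ x ∈ bundle (P := P) f x₀ ν, x p.1 = p.2}ᶜ := by
    rintro p hp ⟨x, hx, hxp⟩
    exact hΦ x hx p.1 (by rwa [hxp])
  obtain ⟨O, hO, hMO, hOG⟩ := normal_exists_closure_subset hM
    (isClosed_graphs_bundle hf ha hfa hν).isOpen_compl hdisj
  refine ⟨closure O, isClosed_closure, hMO.trans (interior_maximal subset_closure hO), ?_⟩
  refine top_le_iff.1 (le_iSup₂_of_le _ ⟨ν, hν, rfl⟩ (le_iInf₂ fun x hx => ?_))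
  exact (hittingTime_eq_top fun t ht => hOG ht ⟨x, hx, rfl⟩).ge

theorem IsRobust.isExact [FiniteDimensional ℝ X] (hf : Continuous f)
    (ha : LocallyIntegrable a lebesgue)
    (hfa : ∀ (t : ℝ≥0) (x : X) (z : P × Q), ‖f (t, x, z)‖ ≤ a t * (1 + ‖x‖))
    (hf_lip : ∀ A : Set (ℝ≥0 × X), IsCompact A → ∃ L : ℝ≥0 → ℝ, Integrable L lebesgue ∧
      ∀ (t : ℝ≥0) (x₁ x₂ : X), (t, x₁) ∈ A → (t, x₂) ∈ A →
        ∀ z : P × Q, ‖f (t, x₁, z) - f (t, x₂, z)‖ ≤ L t * ‖x₁ - x₂‖)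
    {M : Set (ℝ≥0 × X)} (h : IsRobust (bundles f x₀) M) : IsExact (bundles f x₀) M := by
  obtain ⟨M', -, hMM', htop⟩ := h
  have hlate (n : ℕ) : ∃ ν ∈ generalizedControls Q,
      ∀ x ∈ bundle (P := P) f x₀ ν, (n : ℝ≥0∞) < hittingTime M' x := by
    have hn : (n : ℝ≥0∞) < value (bundles f x₀) M' := by
      rw [htop]
      exact ENNReal.natCast_lt_top n
    obtain ⟨_, hn⟩ := lt_iSup_iff.1 hn
    obtain ⟨⟨ν, hν, rfl⟩, hn⟩ := lt_iSup_iff.1 hn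
    exact ⟨ν, hν, fun x hx => hn.trans_le (iInf₂_le x hx)⟩
  choose νs hνs hlate using hlate
  let U := hyperfilter ℕ
  obtain ⟨ν, hν, hνlim⟩ := exists_vagueTendsto U hνs
  refine ⟨bundle f x₀ ν, ⟨ν, hν, rfl⟩, ?_⟩
  rintro x ⟨η, hη, hx⟩ t htM
  rw [isTrajectory_iff_isDelayedTrajectory] at hx
  obtain ⟨θ, η', hθ, hη', hθη', hη'η⟩ := exists_vagueTendsto_consistentControls hν hνs hνlim hη
  choose y hy using fun k => exists_isDelayedTrajectory_zero hf ha hfa x₀ (hη' k)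
  choose z hz using fun k n => exists_isDelayedTrajectory_zero hf ha hfa x₀ (hθ k n).1
  have hpt : Continuous fun x : C(ℝ≥0, X) => (t, x t) := by fun_prop
  have hopen : IsOpen ((fun x : C(ℝ≥0, X) => (t, x t)) ⁻¹' interior M') :=
    isOpen_interior.preimage hpt
  have hyx := tendsto_of_vagueTendsto hf ha hfa hf_lip hη' hη.1 hη'η hy hx
  obtain ⟨k, hk⟩ := (hyx.eventually (hopen.mem_nhds (hMM' htM))).exists
  have hzy := tendsto_of_vagueTendsto hf ha hfa hf_lip (fun n => (hθ k n).1) (hη' k) (hθη' k)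
    (hz k) (hy k)
  obtain ⟨m, hm⟩ := exists_nat_ge t
  have hlarge : ∀ᶠ n in (U : Filter ℕ), m ≤ n :=
    Nat.hyperfilter_le_atTop (eventually_ge_atTop m)
  obtain ⟨n, hn, hmn⟩ := ((hzy.eventually (hopen.mem_nhds hk)).and hlarge).exists
  have h1 := hlate n (z k n) ⟨θ k n, hθ k n, isTrajectory_iff_isDelayedTrajectory.2 (hz k n)⟩
  have h2 : hittingTime M' (z k n) ≤ t := hittingTime_le (interior_subset hn)
  have h3 : (t : ℝ≥0∞) ≤ n := by exact_mod_cast hm.trans (by exact_mod_cast hmn)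
  exact (h1.trans_le (h2.trans h3)).false

end PursuitEvasion

theorem mainTheorem6
    {X E F : Type*}
    [NormedAddCommGroup X] [NormedSpace ℝ X] [FiniteDimensional ℝ X]
    [NormedAddCommGroup E] [NormedSpace ℝ E] [FiniteDimensional ℝ E]
    [MeasurableSpace E] [BorelSpace E]
    [NormedAddCommGroup F] [NormedSpace ℝ F] [FiniteDimensional ℝ F]
    [MeasurableSpace F] [BorelSpace F]
    (P : Set E) (hP : IsCompact P) (Q : Set F) (hQ : IsCompact Q)
    (f : ℝ≥0 × X × P × Q → X) (x₀ : X)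
    (hf_cont : Continuous f)
    (hf_lip : ∀ A : Set (ℝ≥0 × X), IsCompact A →
      ∃ L : ℝ≥0 → ℝ, Integrable L PursuitEvasion.lebesgue ∧
        ∀ (t : ℝ≥0) (x₁ x₂ : X), (t, x₁) ∈ A → (t, x₂) ∈ A →
          ∀ (u : P) (v : Q), ‖f (t, x₁, u, v) - f (t, x₂, u, v)‖ ≤ L t * ‖x₁ - x₂‖)
    (hf_growth : ∃ a : ℝ≥0 → ℝ, LocallyIntegrable a PursuitEvasion.lebesgue ∧
      ∀ (t : ℝ≥0) (x : X) (u : P) (v : Q), ‖f (t, x, u, v)‖ ≤ a t * (1 + ‖x‖))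
    (M : Set (ℝ≥0 × X)) (hM : IsClosed M) :
    PursuitEvasion.IsExact (PursuitEvasion.bundles f x₀) M ↔
      PursuitEvasion.IsRobust (PursuitEvasion.bundles f x₀) M := by
  have : CompactSpace P := isCompact_iff_compactSpace.1 hP
  have : CompactSpace Q := isCompact_iff_compactSpace.1 hQ
  obtain ⟨a, ha, hfa⟩ := hf_growth
  have hfa' : ∀ (t : ℝ≥0) (x : X) (z : P × Q), ‖f (t, x, z)‖ ≤ a t * (1 + ‖x‖) :=
    fun t x z => hfa t x z.1 z.2
  refine ⟨fun h => h.isRobust hf_cont ha hfa' hM, fun h => h.isExact hf_cont ha hfa' ?_⟩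
  intro A hA
  obtain ⟨L, hL, hfL⟩ := hf_lip A hA
  exact ⟨L, hL, fun t x₁ x₂ h₁ h₂ z => hfL t x₁ x₂ h₁ h₂ z.1 z.2⟩
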